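/- Let $n\ge 0$ be an integer, $T>0$, and let $f:\mathbb{R}^n\times[0,T]\to\mathbb{R}^n$ be such that its partial $x$-derivatives up to the second order exist for all $(x,t)$, and $f$ and these derivatives are Lebesgue measurable and uniformly bounded on $\mathbb{R}^n\times[0,T]$. Write $H^0=L_2(\mathbb{R}^n)$, $H^1=W_2^1(\mathbb{R}^n)$ (real-valued functions), $\mathcal{C}^0[a,b]=C([a,b];H^0)$, $\mathcal{C}^0=\mathcal{C}^0[0,T]$, $X^1[a,b]=L^2([a,b];H^1)$, $X^1=X^1[0,T]$, $X_1^0=L^1([0,T];H^0)$, and $$A(x,t)u=\sum_{i=1}^n f_i(x,t)\frac{\partial u}{\partial x_i},\qquad A^*(x,t)u=-\sum_{i=1}^n\frac{\partial}{\partial x_i}\bigl(f_i(x,t)u\bigr)$$ with weak derivatives. For $\varphi\in X^1$, a solution of the backward problem $\partial v/\partial s+Av=-\varphi$, $v(\cdot,T)=0$, is a $v\in\mathcal{C}^0\cap X^1$ with $v(\cdot,s)=\int_s^T(Av+\varphi)(\cdot,t)\,dt$ in $H^0$ for all $s\in[0,T]$. For $s\in[0,T]$ and $\rho_s\in H^1$,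 a solution of the forward problem $\partial p/\partial t=A^*p$, $p(\cdot,s)=\rho_s$, is a $p\in\mathcal{C}^0[s,T]\cap X^1[s,T]$ with $p(\cdot,t)=\rho_s+\int_s^t A^*p(\cdot,\tau)\,d\tau$ in $H^0$ for all $t\in[s,T]$. Let $L:X_1^0\to\mathcal{C}^0$ and $\mathcal{L}_s^*:H^0\to\mathcal{C}^0[s,T]$ be the extensions by continuity of the solution operators $\varphi\mapsto v$ and $\rho_s\mapsto p$ of these problems; that is, $v=L\varphi$ means that $(\varphi,v)$ is a limit in $X_1^0\times\mathcal{C}^0$ of pairs $(\varphi^{(k)},v^{(k)})$ in which $\varphi^{(k)}\in X^1$ and $v^{(k)}$ is a solution of the backward problem for $\varphi^{(k)}$, and likewise for $\mathcal{L}_s^*$ in $H^0\times\mathcal{C}^0[s,T]$. **Lemma 1.2.** If $s\in[0,T]$, $\varphi\in X_1^0$, $\rho_s\in H^0$, $v=L\varphi\in\mathcal{C}^0$ and $\rho=\mathcal{L}_s^*\rho_s\in\mathcal{C}^0[s,T]$, then $t\mapsto(\varphi(\cdot,t),\rho(\cdot,t))_{H^0}$ is integrable on $[s,T]$ and $$(v(\cdot,s),\rho_s)_{H^0}=\int_s^T(\varphi(\cdot,t),\rho(\cdot,t))_{H^0}\,dt.$$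 -/

import Mathlib

open MeasureTheory Set
open scoped ContDiff

noncomputable section

/-- The state space `ℝⁿ`. -/
abbrev StateSpace (n : ℕ) : Type := EuclideanSpace ℝ (Fin n)

/-- The `j`-th standard basis vector of `ℝⁿ`. -/
abbrev stdVec {n : ℕ} (j : Fin n) : StateSpace n := EuclideanSpace.single j (1 : ℝ)

/-- `H⁰ = L²(ℝⁿ)`. -/
abbrev HZero (n : ℕ) : Type := Lp ℝ 2 (volume : Measure (StateSpace n))

/-- `X₁⁰ = L¹([0,T]; H⁰)`. -/
abbrev XOneZero (n : ℕ) (T : ℝ) : Type := Lp (HZero n) 1 (volume.restrict (Icc (0 : ℝ) T))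

/-- `𝒞⁰[a,b] = C([a,b]; H⁰)`, with the supremum norm. -/
abbrev CZero (n : ℕ) (a b : ℝ) : Type := C(Icc a b, HZero n)

/-- The classical partial derivative `∂g/∂xⱼ` (meaningful where it exists). -/
def partialX {n : ℕ} (j : Fin n) (g : StateSpace n → ℝ) (x : StateSpace n) : ℝ :=
  lineDeriv ℝ g x (stdVec j)

/-- The standing assumptions on the vector field `f(x,t)`, `x ∈ ℝⁿ`, `t ∈ [0,T]`: the partial
`x`-derivatives of its components up to the second order exist for every `(x,t)`, and they and `f`
are Lebesgue measurable and uniformly bounded. -/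
structure RegularField {n : ℕ} (T : ℝ) (f : StateSpace n → ℝ → StateSpace n) : Prop where
  measurable_field : ∀ i : Fin n, AEMeasurable (fun z : StateSpace n × ℝ => f z.1 z.2 i)
    (volume.prod (volume.restrict (Icc 0 T)))
  measurable_first : ∀ i j : Fin n,
    AEMeasurable (fun z : StateSpace n × ℝ => partialX j (fun y => f y z.2 i) z.1)
      (volume.prod (volume.restrict (Icc 0 T)))
  measurable_second : ∀ i j k : Fin n,
    AEMeasurable (fun z : StateSpace n × ℝ => partialX k (partialX j (fun y => f y z.2 i)) z.1)
      (volume.prod (volume.restrict (Icc 0 T)))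
  exists_first : ∀ t ∈ Icc 0 T, ∀ (x : StateSpace n) (i j : Fin n),
    LineDifferentiableAt ℝ (fun y => f y t i) x (stdVec j)
  exists_second : ∀ t ∈ Icc 0 T, ∀ (x : StateSpace n) (i j k : Fin n),
    LineDifferentiableAt ℝ (partialX j (fun y => f y t i)) x (stdVec k)
  bounded : ∃ K : ℝ, ∀ t ∈ Icc 0 T, ∀ (x : StateSpace n) (i j k : Fin n),
    |f x t i| ≤ K ∧ |partialX j (fun y => f y t i) x| ≤ K ∧
      |partialX k (partialX j (fun y => f y t i)) x| ≤ K

/-- `w = ∂u/∂xᵢ` in the weak sense on `ℝⁿ`. -/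
def HasWeakPartial {n : ℕ} (i : Fin n) (u w : StateSpace n → ℝ) : Prop :=
  LocallyIntegrable u ∧ LocallyIntegrable w ∧
    ∀ ψ : StateSpace n → ℝ, ContDiff ℝ ∞ ψ → HasCompactSupport ψ →
      ∫ x, u x * fderiv ℝ ψ x (stdVec i) = -∫ x, w x * ψ x

/-- `u ∈ H¹ = W₂¹(ℝⁿ)`. -/
def MemHOne {n : ℕ} (u : HZero n) : Prop :=
  ∀ i : Fin n, ∃ w : HZero n, HasWeakPartial i u w

/-- `u ∈ X¹[a,b] = L²([a,b]; H¹)`: `u` and its weak `x`-derivatives are in `L²([a,b]; L²(ℝⁿ))`. -/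
def MemXOne {n : ℕ} (a b : ℝ) (u : ℝ → HZero n) : Prop :=
  MemLp u 2 (volume.restrict (Icc a b)) ∧
    ∀ i : Fin n, ∃ w : ℝ → HZero n, MemLp w 2 (volume.restrict (Icc a b)) ∧
      ∀ᵐ t ∂(volume.restrict (Icc a b)), HasWeakPartial i (u t) (w t)

/-- `h = A(·,t) u`, where `A(x,t) u = ∑ᵢ fᵢ(x,t) ∂u/∂xᵢ`. -/
def IsTransport {n : ℕ} (f : StateSpace n → ℝ → StateSpace n) (t : ℝ) (u h : HZero n) : Prop :=
  ∃ w : Fin n → HZero n, (∀ i, HasWeakPartial i (u : StateSpace n → ℝ) (w i)) ∧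
    (h : StateSpace n → ℝ) =ᵐ[volume] fun x => ∑ i, f x t i * w i x

/-- `h = A*(·,t) u`, where `A*(x,t) u = -∑ᵢ ∂(fᵢ(x,t) u)/∂xᵢ`. -/
def IsAdjointTransport {n : ℕ} (f : StateSpace n → ℝ → StateSpace n) (t : ℝ) (u h : HZero n) :
    Prop :=
  ∃ q : Fin n → HZero n, (∀ i, HasWeakPartial i (fun x => f x t i * u x) (q i)) ∧
    (h : StateSpace n → ℝ) =ᵐ[volume] fun x => -∑ i, q i x

/-- `v ∈ 𝒞⁰ ∩ X¹` solves the backward Cauchy problem `∂v/∂s + A v = -φ`, `v(·,T) = 0`,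
in integrated form: `v(s) = ∫_s^T (A v + φ) dt` in `H⁰` for all `s ∈ [0,T]`. -/
def SolvesBackward {n : ℕ} {T : ℝ} (hT : 0 ≤ T) (f : StateSpace n → ℝ → StateSpace n)
    (φ : ℝ → HZero n) (v : CZero n 0 T) : Prop :=
  MemXOne 0 T (IccExtend hT v) ∧
    ∃ g : ℝ → HZero n, IntegrableOn g (Icc 0 T) ∧
      (∀ᵐ t ∂(volume.restrict (Icc 0 T)), IsTransport f t (IccExtend hT v t) (g t)) ∧
      ∀ s : Icc (0 : ℝ) T, v s = ∫ t in (s : ℝ)..T, (g t + φ t)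

/-- `p ∈ 𝒞⁰[s,T] ∩ X¹[s,T]` solves the forward Cauchy problem `∂p/∂t = A* p`, `p(·,s) = ρ_s`,
in integrated form: `p(t) = ρ_s + ∫_s^t A* p dτ` in `H⁰` for all `t ∈ [s,T]`. -/
def SolvesForward {n : ℕ} {s T : ℝ} (hsT : s ≤ T) (f : StateSpace n → ℝ → StateSpace n)
    (ρs : HZero n) (p : CZero n s T) : Prop :=
  MemXOne s T (IccExtend hsT p) ∧
    ∃ g : ℝ → HZero n, IntegrableOn g (Icc s T) ∧
      (∀ᵐ t ∂(volume.restrict (Icc s T)), IsAdjointTransport f t (IccExtend hsT p t) (g t)) ∧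
      ∀ t : Icc s T, p t = ρs + ∫ τ in s..(t : ℝ), g τ

/-- The graph of the solution operator `φ ↦ v` of the backward problem, on `φ ∈ X¹`. -/
def backwardGraph {n : ℕ} {T : ℝ} (hT : 0 ≤ T) (f : StateSpace n → ℝ → StateSpace n) :
    Set (XOneZero n T × CZero n 0 T) :=
  {z | MemXOne 0 T z.1 ∧ SolvesBackward hT f z.1 z.2}

/-- The graph of the solution operator `ρ_s ↦ p` of the forward problem, on `ρ_s ∈ H¹`. -/
def forwardGraph {n : ℕ} {s T : ℝ} (hsT : s ≤ T) (f : StateSpace n → ℝ → StateSpace n) :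
    Set (HZero n × CZero n s T) :=
  {z | MemHOne z.1 ∧ SolvesForward hsT f z.1 z.2}

/-- The operator `L : X₁⁰ → 𝒞⁰`, the extension by continuity of the solution operator of the
backward problem: `L φ` is the `v` such that `(φ, v)` is a limit in `X₁⁰ × 𝒞⁰` of pairs
`(φ⁽ᵏ⁾, v⁽ᵏ⁾)` with `φ⁽ᵏ⁾ ∈ X¹` and `v⁽ᵏ⁾` the solution for `φ⁽ᵏ⁾`. -/
def operatorL {n : ℕ} {T : ℝ} (hT : 0 ≤ T) (f : StateSpace n → ℝ → StateSpace n)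
    (φ : XOneZero n T) : CZero n 0 T :=
  Classical.epsilon fun v => (φ, v) ∈ closure (backwardGraph hT f)

/-- The operator `𝓛ₛ* : H⁰ → 𝒞⁰[s,T]`, the extension by continuity of the solution operator of
the forward problem: `𝓛ₛ* ρ_s` is the `p` such that `(ρ_s, p)` is a limit in `H⁰ × 𝒞⁰[s,T]` of
pairs `(ρ⁽ᵏ⁾, p⁽ᵏ⁾)` with `ρ⁽ᵏ⁾ ∈ H¹` and `p⁽ᵏ⁾` the solution for `ρ⁽ᵏ⁾`. -/
def operatorLstar {n : ℕ} {s T : ℝ} (hsT : s ≤ T) (f : StateSpace n → ℝ → StateSpace n)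
    (ρs : HZero n) : CZero n s T :=
  Classical.epsilon fun p => (ρs, p) ∈ closure (forwardGraph hsT f)

end

/-! For genuine solutions the formula is a product rule. For almost every `t`, `(v, p)' = -(A v + φ,
p) + (v, A* p) = -(φ, p)`, because `A` and `A*` are adjoint through weak derivatives; integrating
over `[s, T]` with `v(T) = 0` gives the claim (`IsFieldCoefficients.inner_eq_integral`). Both sides
depend continuously on `(φ, v)` and on `(ρ_s, p)` in the norms of the two graphs, so the identity
passes to the closures. Uniqueness of the limits plays no role in this.

The real work is to show that `(φ, L φ)` and `(ρ_s, 𝓛ₛ* ρ_s)` lie in those closures: the operators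
are defined by choice, so nothing is known about their values until some point of the closure is
found over the given datum. By `exists_mem_closure_of_stable` this needs a Lipschitz bound on each
graph and solvability for a dense set of data. Forward stability is the energy inequality `(A* p, p)
≤ n C ‖p‖²` together with a Gronwall argument. Backward stability then follows from the duality
formula for genuine solutions, by testing `v(s)` against smooth `ρ_s`.

Solvability comes from replacing `∂ᵢ` by centred difference quotients. These are bounded and
skew-adjoint, commute with each other and with integration in time, and have commutators with
Lipschitz multipliers bounded uniformly in the step (`norm_diffQuot_mulOp_sub_le`). After an
exponential weight in time the spatial operator `B` is strictly dissipative, while integration `V`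
from the endpoint carrying the zero datum is accretive up to sign; so `G = B V G + φ` is solvable in
`L²([a,b]; H⁰)` by pure Hilbert space theory (`exists_eq_dissipative_add`). Applying the quotients
to the equation bounds the quotients of `u = V G` uniformly (`TransportData.exists_solution`), and
weak limits give a solution together with its weak derivatives (`exists_limit_solution`,
`exists_weak_evolution`). For `A*` the bounded second derivatives of `f` are needed, to make the
zero-order coefficient Lipschitz. -/

open Filter Topology

/-! ### Dissipative equations in Hilbert space and their weak limits -/

section AbstractHilbert

variable {𝓗 : Type*} [NormedAddCommGroup 𝓗] [InnerProductSpace ℝ 𝓗] [CompleteSpace 𝓗]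

/-- Bounded sequences in a Hilbert space converge weakly along ultrafilters. -/
theorem exists_weak_ultralimit {α : Type*} (U : Ultrafilter α) (x : α → 𝓗) (R : ℝ)
    (hR : ∀ k, ‖x k‖ ≤ R) :
    ∃ z : 𝓗, ∀ y, Tendsto (fun k => inner ℝ (x k) y) U (𝓝 (inner ℝ z y)) := by
  have hlim : ∀ y : 𝓗, ∃ l : ℝ, Tendsto (fun k => inner ℝ (x k) y) U (𝓝 l) := by
    intro y
    have hmem : ∀ k, inner ℝ (x k) y ∈ Metric.closedBall (0 : ℝ) (R * ‖y‖) := fun k => by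
      rw [mem_closedBall_zero_iff]
      exact (norm_inner_le_norm _ _).trans (by gcongr; exact hR k)
    obtain ⟨l, -, hl⟩ := (isCompact_closedBall (0 : ℝ) (R * ‖y‖)).ultrafilter_le_nhds
      (U.map fun k => inner ℝ (x k) y)
      (by rw [le_principal_iff]; exact Filter.mem_map.2 (univ_mem' hmem))
    exact ⟨l, hl⟩
  choose l hl using hlim
  let ℓ : 𝓗 →ₗ[ℝ] ℝ :=
    { toFun := l
      map_add' := fun y y' => tendsto_nhds_unique (hl (y + y'))
        (by simpa only [inner_add_right] using (hl y).add (hl y'))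
      map_smul' := fun c y => tendsto_nhds_unique (hl (c • y))
        (by simpa only [inner_smul_right, smul_eq_mul, RingHom.id_apply] using (hl y).const_mul c) }
  have hb : ∀ y, ‖ℓ y‖ ≤ R * ‖y‖ := fun y =>
    le_of_tendsto (hl y).norm (Eventually.of_forall fun k =>
      (norm_inner_le_norm _ _).trans (by gcongr; exact hR k))
  refine ⟨(InnerProductSpace.toDual ℝ 𝓗).symm (ℓ.mkContinuous R hb), fun y => ?_⟩
  rw [InnerProductSpace.toDual_symm_apply]
  exact hl y

/-- If `B` is strictly dissipative and `V` is accretive then `1 - B V` is onto. -/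
theorem exists_eq_dissipative_add (V B : 𝓗 →L[ℝ] 𝓗) (hV : ∀ x, 0 ≤ inner ℝ (V x) x)
    {δ : ℝ} (hδ : 0 < δ) (hB : ∀ x, inner ℝ (B x) x ≤ -δ * ‖x‖ ^ 2) (φ : 𝓗) :
    ∃ G, G = B (V G) + φ := by
  let S : 𝓗 →L[ℝ] 𝓗 := ContinuousLinearMap.id ℝ 𝓗 - B ∘L V
  have hS : ∀ G, S G = G - B (V G) := fun G => rfl
  have hVG : ∀ G, δ * ‖V G‖ ≤ ‖S G‖ := by
    intro G
    have h1 : inner ℝ (V G) (S G) ≤ ‖V G‖ * ‖S G‖ := real_inner_le_norm _ _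
    have h2 : inner ℝ (V G) (S G) = inner ℝ (V G) G - inner ℝ (B (V G)) (V G) := by
      rw [hS, inner_sub_right, real_inner_comm (B (V G))]
    have h3 := hV G
    have h4 := hB (V G)
    rcases (norm_nonneg (V G)).eq_or_lt with h | h
    · rw [← h]; simp
    · refine le_of_mul_le_mul_left ?_ h
      nlinarith
  have hanti : ∀ G, ‖G‖ ≤ (1 + ‖B‖ / δ) * ‖S G‖ := by
    intro G
    have h1 : G = S G + B (V G) := by rw [hS]; abel
    have h2 : ‖V G‖ ≤ ‖S G‖ / δ := by
      rw [le_div_iff₀ hδ, mul_comm]; exact hVG G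
    calc ‖G‖ = ‖S G + B (V G)‖ := by rw [← h1]
      _ ≤ ‖S G‖ + ‖B‖ * ‖V G‖ := (norm_add_le _ _).trans (by gcongr; exact B.le_opNorm _)
      _ ≤ ‖S G‖ + ‖B‖ * (‖S G‖ / δ) := by gcongr
      _ = _ := by ring
  have hclosed : IsClosed (S.range : Set 𝓗) := by
    have : AntilipschitzWith (Real.toNNReal (1 + ‖B‖ / δ)) S :=
      S.antilipschitz_of_bound fun x => by
        rw [Real.coe_toNNReal _ (by positivity)]; exact hanti x
    have h := this.isClosed_range S.uniformContinuous
    exact h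
  have hperp : S.rangeᗮ = ⊥ := by
    rw [Submodule.eq_bot_iff]
    intro z hz
    have hz' : ∀ G, inner ℝ z G = inner ℝ z (B (V G)) := fun G => by
      have := (Submodule.mem_orthogonal _ _).1 hz (S G) ⟨G, rfl⟩
      rw [hS, inner_sub_left] at this
      rw [real_inner_comm, real_inner_comm (B (V G))]
      linarith
    -- Orthogonality reads `(z, G) = (y, V G)` for all `G`. The choice `G = y` gives `(z, y) ≥ 0`,
    -- whereas `(z, y) = (B z, z) ≤ -δ ‖z‖²`.
    let y := (ContinuousLinearMap.adjoint B) z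
    have h1 : ∀ G, inner ℝ z G = inner ℝ y (V G) := fun G => by
      rw [hz' G, ContinuousLinearMap.adjoint_inner_left]
    have h2 : 0 ≤ inner ℝ z y := by
      rw [h1, real_inner_comm]; exact hV y
    have h3 : inner ℝ z y = inner ℝ (B z) z := ContinuousLinearMap.adjoint_inner_right _ _ _
    have h4 := hB z
    have h5 : ‖z‖ ^ 2 ≤ 0 := by nlinarith
    exact norm_eq_zero.1 (by nlinarith [norm_nonneg z])
  have htop : S.range = ⊤ := by
    have : CompleteSpace S.range := hclosed.completeSpace_coe
    exact Submodule.orthogonal_eq_bot_iff.1 hperp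
  obtain ⟨G, hG⟩ : φ ∈ S.range := htop ▸ Submodule.mem_top
  refine ⟨G, ?_⟩
  have : S G = φ := hG
  rw [hS] at this
  rw [← this]; abel

variable {ι : Type*} [Fintype ι]

-- Skewness of `D` and symmetry of `M` give `2 (M D x, x) = -(x, [D, M] x)`: a first-order term
-- costs only a commutator in the energy, however large `D` is.
omit [CompleteSpace 𝓗] in
theorem inner_commutator_bound (D M : 𝓗 →L[ℝ] 𝓗) {L : ℝ}
    (hD : ∀ x y, inner ℝ (D x) y = -inner ℝ x (D y))
    (hM : ∀ x y, inner ℝ (M x) y = inner ℝ x (M y))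
    (hDM : ∀ x, ‖D (M x) - M (D x)‖ ≤ L * ‖x‖) (x : 𝓗) :
    2 * inner ℝ (M (D x)) x ≤ L * ‖x‖ ^ 2 := by
  have h1 : inner ℝ (M (D x)) x = -inner ℝ x (D (M x)) := by rw [hM, hD]
  have h2 : inner ℝ (M (D x)) x = inner ℝ x (M (D x)) := real_inner_comm _ _
  have h3 : 2 * inner ℝ (M (D x)) x = -inner ℝ x (D (M x) - M (D x)) := by
    rw [inner_sub_right]; linarith
  rw [h3]
  have h4 := (abs_le.1 (abs_real_inner_le_norm x (D (M x) - M (D x)))).1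
  nlinarith [hDM x, norm_nonneg x]

/-- Data of a regularised transport operator: bounded skew-adjoint "derivatives" `D i`, symmetric
"coefficients" `M i` and a zero-order term `N`, with commutators controlled by `L`. -/
structure TransportData (V : 𝓗 →L[ℝ] 𝓗) (M : ι → 𝓗 →L[ℝ] 𝓗) (N : 𝓗 →L[ℝ] 𝓗) (L K : ℝ)
    (D : ι → 𝓗 →L[ℝ] 𝓗) : Prop where
  skew : ∀ i x y, inner ℝ (D i x) y = -inner ℝ x (D i y)
  comm_V : ∀ i x, D i (V x) = V (D i x)
  comm_D : ∀ i j x, D i (D j x) = D j (D i x)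
  symm_M : ∀ i x y, inner ℝ (M i x) y = inner ℝ x (M i y)
  norm_N : ∀ x, ‖N x‖ ≤ K * ‖x‖
  comm_M : ∀ i j x, ‖D j (M i x) - M i (D j x)‖ ≤ L * ‖x‖
  comm_N : ∀ j x, ‖D j (N x) - N (D j x)‖ ≤ L * ‖x‖

/-- The bounds involve no norm of `D`, which is what permits the limit. In `lam`, one `n L` and `K`
absorb the first-order and zero-order terms; the remaining `n L + 1` is the dissipation. When `D j`
is applied to the equation, the commutators contribute `L ∑ᵢ ‖D i u‖`, and after summation over `j`
exactly the second `n L` absorbs them. -/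
theorem TransportData.exists_solution {V : 𝓗 →L[ℝ] 𝓗} {M : ι → 𝓗 →L[ℝ] 𝓗} {N : 𝓗 →L[ℝ] 𝓗}
    {L K : ℝ} {D : ι → 𝓗 →L[ℝ] 𝓗} (h : TransportData V M N L K D) (hL : 0 ≤ L)
    (hV : ∀ x, 0 ≤ inner ℝ (V x) x) {lam : ℝ}
    (hlam : lam = 2 * Fintype.card ι * L + K + 1) (φ : 𝓗) {R : ℝ} (hR : ∀ j, ‖D j φ‖ ≤ R) :
    ∃ G, G = ∑ i, M i (D i (V G)) + N (V G) - lam • V G + φ ∧ ‖V G‖ ≤ ‖φ‖ ∧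
      ∀ j, ‖D j (V G)‖ ≤ Fintype.card ι * (L * ‖φ‖ + R) := by
  set n : ℝ := (Fintype.card ι : ℝ) with hn
  have hn0 : 0 ≤ n := Nat.cast_nonneg _
  let B : 𝓗 →L[ℝ] 𝓗 := ∑ i, M i ∘L D i + N - lam • ContinuousLinearMap.id ℝ 𝓗
  have hBx : ∀ x, B x = ∑ i, M i (D i x) + N x - lam • x := fun x => by
    simp [B]
  have hB : ∀ x, inner ℝ (B x) x ≤ -(n * L + 1) * ‖x‖ ^ 2 := fun x => by
    rw [hBx, inner_sub_left, inner_add_left, sum_inner, real_inner_smul_left,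
      real_inner_self_eq_norm_sq]
    have h1 : ∑ i, inner ℝ (M i (D i x)) x ≤ ∑ _i : ι, L * ‖x‖ ^ 2 := by
      refine Finset.sum_le_sum fun i _ => ?_
      have h1 := inner_commutator_bound (D i) (M i) (h.skew i) (h.symm_M i) (h.comm_M i i) x
      have : 0 ≤ L * ‖x‖ ^ 2 := by positivity
      linarith
    rw [Finset.sum_const, Finset.card_univ, nsmul_eq_mul, ← hn] at h1
    have h2 : inner ℝ (N x) x ≤ K * ‖x‖ ^ 2 := by
      have := real_inner_le_norm (N x) x
      nlinarith [h.norm_N x, norm_nonneg x]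
    rw [hlam]
    nlinarith
  have hδ : 0 < n * L + 1 := by positivity
  obtain ⟨G, hG⟩ := exists_eq_dissipative_add V B hV hδ hB φ
  -- a general energy inequality
  have key : ∀ F r : 𝓗, F = B (V F) + r → (n * L + 1) * ‖V F‖ ≤ ‖r‖ := by
    intro F r hF
    have h1 := hV F
    have h2 : inner ℝ (V F) F = inner ℝ (B (V F)) (V F) + inner ℝ (V F) r := by
      rw [real_inner_comm (V F) (B (V F)), ← inner_add_right, ← hF]
    have h3 := hB (V F)
    have h4 := real_inner_le_norm (V F) r
    rcases (norm_nonneg (V F)).eq_or_lt with h | h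
    · rw [← h]; simp
    · refine le_of_mul_le_mul_left ?_ h
      nlinarith
  have hu : ‖V G‖ ≤ ‖φ‖ := by
    have := key G φ hG
    have : 0 ≤ n * L * ‖V G‖ := by positivity
    linarith
  refine ⟨G, by rw [← hBx]; exact hG, hu, ?_⟩
  set u := V G with hudef
  have hDj : ∀ j, (n * L + 1) * ‖D j u‖ ≤ ∑ i, L * ‖D i u‖ + (L * ‖φ‖ + R) := by
    intro j
    -- `D j G` solves the same equation with a new source made of commutators, so the energy
    -- inequality `key` applies to it.
    have e : D j G = B (V (D j G)) +
        (∑ i, (D j (M i (D i u)) - M i (D j (D i u))) + (D j (N u) - N (D j u)) + D j φ) := by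
      rw [← h.comm_V]
      conv_lhs => rw [hG]
      rw [← hudef, hBx, hBx]
      simp only [map_add, map_sub, map_sum, map_smul, Finset.sum_sub_distrib, h.comm_D j]
      abel
    have := key _ _ e
    rw [← h.comm_V] at this
    refine this.trans ?_
    refine (norm_add_le _ _).trans ?_
    refine (add_le_add_left (norm_add_le _ _) _).trans ?_
    rw [add_assoc]
    refine add_le_add ((norm_sum_le _ _).trans (Finset.sum_le_sum fun i _ => h.comm_M i j _)) ?_
    refine add_le_add ((h.comm_N j _).trans (by gcongr)) (hR j)
  have hsum : ∑ j, ‖D j u‖ ≤ n * (L * ‖φ‖ + R) := by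
    have := Finset.sum_le_sum fun j (_ : j ∈ Finset.univ) => hDj j
    rw [← Finset.mul_sum, Finset.sum_const, Finset.card_univ, nsmul_eq_mul, ← hn,
      ← Finset.mul_sum] at this
    linarith
  exact fun j => (Finset.single_le_sum (f := fun j => ‖D j u‖) (fun _ _ => norm_nonneg _)
    (Finset.mem_univ j)).trans hsum

/-- Passage to the limit in the regularised transport equations. -/
theorem exists_limit_solution {V : 𝓗 →L[ℝ] 𝓗} {M : ι → 𝓗 →L[ℝ] 𝓗} {N : 𝓗 →L[ℝ] 𝓗} {L K : ℝ}
    {D : ℕ → ι → 𝓗 →L[ℝ] 𝓗} (h : ∀ k, TransportData V M N L K (D k)) (hL : 0 ≤ L)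
    (hV : ∀ x, 0 ≤ inner ℝ (V x) x) {lam : ℝ}
    (hlam : lam = 2 * Fintype.card ι * L + K + 1) (φ : 𝓗) {R : ℝ} (hR : ∀ k j, ‖D k j φ‖ ≤ R) :
    ∃ (G : 𝓗) (w : ι → 𝓗), G = ∑ i, M i (w i) + N (V G) - lam • V G + φ ∧
      ∀ i y z, Tendsto (fun k => D k i y) atTop (𝓝 z) → inner ℝ (w i) y = -inner ℝ (V G) z := by
  choose G hG hVG hDG using fun k => (h k).exists_solution hL hV hlam φ (hR k)
  -- A free ultrafilter replaces the extraction of weakly convergent subsequences.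
  let U := Filter.hyperfilter ℕ
  have hU : (U : Filter ℕ) ≤ atTop := by
    rw [← Nat.cofinite_eq_atTop]; exact Filter.hyperfilter_le_cofinite
  obtain ⟨u, hu⟩ := exists_weak_ultralimit U (fun k => V (G k)) _ hVG
  choose w hw using fun i => exists_weak_ultralimit U (fun k => D k i (V (G k))) _ fun k => hDG k i
  have weakmap : ∀ (T : 𝓗 →L[ℝ] 𝓗) {x : ℕ → 𝓗} {z : 𝓗},
      (∀ y, Tendsto (fun k => inner ℝ (x k) y) U (𝓝 (inner ℝ z y))) →
      ∀ y, Tendsto (fun k => inner ℝ (T (x k)) y) U (𝓝 (inner ℝ (T z) y)) := by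
    intro T x z hx y
    simpa only [ContinuousLinearMap.adjoint_inner_right] using
      hx (ContinuousLinearMap.adjoint T y)
  set F := ∑ i, M i (w i) + N u - lam • u + φ with hF
  have hGF : ∀ y, Tendsto (fun k => inner ℝ (G k) y) U (𝓝 (inner ℝ F y)) := by
    intro y
    have h1 : ∀ k, inner ℝ (G k) y = ∑ i, inner ℝ (M i (D k i (V (G k)))) y +
        inner ℝ (N (V (G k))) y - lam * inner ℝ (V (G k)) y + inner ℝ φ y := fun k => by
      conv_lhs => rw [hG k]
      rw [inner_add_left, inner_sub_left, inner_add_left, sum_inner, real_inner_smul_left]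
    simp_rw [h1]
    rw [hF, inner_add_left, inner_sub_left, inner_add_left, sum_inner, real_inner_smul_left]
    exact (((tendsto_finsetSum _ fun i _ => weakmap (M i) (hw i) y).add
      (weakmap N hu y)).sub ((hu y).const_mul lam)).add tendsto_const_nhds
  -- Bounded operators are weakly continuous, and the equation is linear with `V`, `M i`, `N`
  -- independent of `k`, so no strong compactness is required.
  have hVF : V F = u := ext_inner_right ℝ fun y =>
    tendsto_nhds_unique (weakmap V hGF y) (hu y)
  refine ⟨F, w, by rw [hVF], fun i y z hyz => ?_⟩
  rw [hVF]
  refine tendsto_nhds_unique (hw i y) ?_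
  simp_rw [(h _).skew i]
  refine Tendsto.neg ?_
  -- Pairing of a weakly with a strongly convergent sequence: the uniform bound on `V (G k)` lets `D
  -- k i y` be replaced by its limit `z`.
  have h1 : Tendsto (fun k => inner ℝ (V (G k)) (D k i y - z)) U (𝓝 0) := by
    have h2 : Tendsto (fun k => ‖φ‖ * ‖D k i y - z‖) U (𝓝 0) := by
      have := ((hyz.mono_left hU).sub_const z).norm.const_mul ‖φ‖
      simpa using this
    refine squeeze_zero_norm (fun k => ?_) h2
    exact (norm_inner_le_norm _ _).trans (by gcongr; exact hVG k)
  have h3 := h1.add (hu z)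
  simp only [inner_sub_right, sub_add_cancel, zero_add] at h3
  exact h3

end AbstractHilbert

/-! ### Closures of stable relations and measurability of curves -/

section Generic

/-- A relation which is Lipschitz from its first to its second component and has dense domain has
a closure with full domain. -/
theorem exists_mem_closure_of_stable {E F : Type*} [NormedAddCommGroup E]
    [NormedAddCommGroup F] [CompleteSpace F] (Γ : Set (E × F)) (C : ℝ)
    (hC : ∀ z ∈ Γ, ∀ z' ∈ Γ, ‖z.2 - z'.2‖ ≤ C * ‖z.1 - z'.1‖) (hd : Dense (Prod.fst '' Γ))
    (x : E) : ∃ y, (x, y) ∈ closure Γ := by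
  obtain ⟨ξ, hξ, hlim⟩ := mem_closure_iff_seq_limit.1 (hd x)
  choose z hz hzξ using hξ
  obtain rfl : ξ = fun k => (z k).1 := funext fun k => (hzξ k).symm
  have hcau : CauchySeq fun k => (z k).2 := by
    have h1 := hlim.cauchySeq
    rw [Metric.cauchySeq_iff] at h1 ⊢
    intro ε hε
    obtain ⟨N, hN⟩ := h1 (ε / (|C| + 1)) (by positivity)
    refine ⟨N, fun m hm l hl => ?_⟩
    have h2 := hN m hm l hl
    rw [dist_eq_norm, lt_div_iff₀ (by positivity)] at h2
    rw [dist_eq_norm]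
    refine ((hC _ (hz m) _ (hz l)).trans ?_).trans_lt h2
    rw [mul_comm]
    gcongr
    linarith [le_abs_self C]
  obtain ⟨y, hy⟩ := cauchySeq_tendsto_of_complete hcau
  exact ⟨y, mem_closure_of_tendsto (hlim.prodMk_nhds hy) (Eventually.of_forall hz)⟩

/-- Weakly measurable functions with values in a separable Hilbert space are measurable. -/
theorem aestronglyMeasurable_of_inner {α H : Type*} [MeasurableSpace α] {μ : Measure α}
    [NormedAddCommGroup H] [InnerProductSpace ℝ H] [CompleteSpace H]
    [TopologicalSpace.SeparableSpace H] {F : α → H}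
    (hF : ∀ y : H, AEStronglyMeasurable (fun t => inner ℝ y (F t)) μ) :
    AEStronglyMeasurable F μ := by
  obtain ⟨w, e, he⟩ := exists_hilbertBasis ℝ H
  -- Orthonormal vectors are at distance `√2`, so the balls of radius `1/2` are disjoint and
  -- separability leaves countably many. Countability makes the filter of finite subsets countably
  -- generated, so limits of its partial sums stay measurable.
  have hc : Countable w := by
    have ho := e.orthonormal
    rw [he] at ho
    have hdisj : (w : Set H).PairwiseDisjoint fun x => Metric.ball x (1 / 2) := by
      intro x hx y hy hxy
      refine Metric.ball_disjoint_ball ?_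
      have h1 : ‖x - y‖ ^ 2 = 2 := by
        have hx1 : ‖x‖ = 1 := ho.1 ⟨x, hx⟩
        have hy1 : ‖y‖ = 1 := ho.1 ⟨y, hy⟩
        have hxy0 : inner ℝ x y = 0 :=
          ho.2 (i := ⟨x, hx⟩) (j := ⟨y, hy⟩) fun h => hxy (congrArg Subtype.val h)
        rw [norm_sub_sq_real, hx1, hy1, hxy0]; norm_num
      rw [dist_eq_norm]
      nlinarith [norm_nonneg (x - y)]
    exact (hdisj.countable_of_isOpen (fun _ _ => Metric.isOpen_ball)
      fun x _ => ⟨x, Metric.mem_ball_self (by norm_num)⟩).to_subtype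
  refine aestronglyMeasurable_of_tendsto_ae (u := (atTop : Filter (Finset w)))
    (f := fun s t => ∑ i ∈ s, inner ℝ (e i) (F t) • e i) (fun s => ?_)
    (Eventually.of_forall fun t => ?_)
  · exact Finset.aestronglyMeasurable_fun_sum _ fun i _ => (hF (e i)).smul_const _
  · have := e.hasSum_repr (F t)
    simp only [e.repr_apply_apply] at this
    exact this

/-! ### Primitives of integrable functions and their product rule -/

variable {E F G : Type*} [NormedAddCommGroup E] [NormedSpace ℝ E]
  [NormedAddCommGroup F] [NormedSpace ℝ F]
  [NormedAddCommGroup G] [NormedSpace ℝ G]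

/-- `u` is on `[a,b]` a primitive of the integrable function `g`. -/
structure IsPrimitive (a b : ℝ) (u g : ℝ → E) : Prop where
  integrableOn : IntegrableOn g (Icc a b)
  eq_add : ∀ t ∈ Icc a b, u t = u a + ∫ τ in a..t, g τ

namespace IsPrimitive

variable {a b : ℝ} {u g : ℝ → E} {v k : ℝ → F}

theorem intervalIntegrable (h : IsPrimitive a b u g) {s t : ℝ} (hs : s ∈ Icc a b)
    (ht : t ∈ Icc a b) : IntervalIntegrable g volume s t :=
  (h.integrableOn.mono_set (uIcc_subset_Icc hs ht)).intervalIntegrable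

theorem sub_eq [CompleteSpace E] (h : IsPrimitive a b u g) {s t : ℝ} (hs : s ∈ Icc a b) (ht : t ∈ Icc a b) :
    u t - u s = ∫ τ in s..t, g τ := by
  have ha : a ∈ Icc a b := ⟨le_rfl, hs.1.trans hs.2⟩
  rw [h.eq_add t ht, h.eq_add s hs, add_sub_add_left_eq_sub,
    intervalIntegral.integral_interval_sub_left (h.intervalIntegrable ha ht)
      (h.intervalIntegrable ha hs)]

theorem mono [CompleteSpace E] (h : IsPrimitive a b u g) {c : ℝ} (hc : c ∈ Icc a b) : IsPrimitive c b u g where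
  integrableOn := h.integrableOn.mono_set (Icc_subset_Icc_left hc.1)
  eq_add t ht := by
    rw [← h.sub_eq hc ⟨hc.1.trans ht.1, ht.2⟩]; abel

theorem continuousOn [CompleteSpace E] (h : IsPrimitive a b u g) : ContinuousOn u (Icc a b) := by
  have h1 := intervalIntegral.continuousOn_primitive_Icc (μ := volume) h.integrableOn
  refine (continuousOn_const.add h1 : ContinuousOn (fun t => u a + ∫ τ in Icc a t, g τ) _).congr
    fun t ht => ?_
  change _ = u a + ∫ τ in Icc a t, g τ
  rw [h.eq_add t ht, intervalIntegral.integral_of_le ht.1, integral_Icc_eq_integral_Ioc]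

theorem exists_bound [CompleteSpace E] (h : IsPrimitive a b u g) : ∃ C, 0 ≤ C ∧ ∀ t ∈ Icc a b, ‖u t‖ ≤ C := by
  obtain ⟨C, hC⟩ := isCompact_Icc.exists_bound_of_continuousOn h.continuousOn
  exact ⟨|C|, abs_nonneg C, fun t ht => (hC t ht).trans (le_abs_self C)⟩

theorem aestronglyMeasurable [CompleteSpace E] (h : IsPrimitive a b u g) :
    AEStronglyMeasurable u (volume.restrict (Icc a b)) :=
  ContinuousOn.aestronglyMeasurable_of_isCompact h.continuousOn isCompact_Icc measurableSet_Icc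

theorem ae_hasDerivAt [CompleteSpace E] (h : IsPrimitive a b u g) :
    ∀ᵐ t, t ∈ Icc a b → HasDerivAt u (g t) t := by
  rcases le_or_gt a b with hab | hab
  swap
  · simp [Icc_eq_empty hab.not_ge]
  have ha : a ∈ Icc a b := ⟨le_rfl, hab⟩
  have hb : b ∈ Icc a b := ⟨hab, le_rfl⟩
  have h1 := (h.intervalIntegrable ha hb).ae_hasDerivAt_integral
  have h2 : ∀ᵐ t : ℝ, t ≠ a ∧ t ≠ b := by
    filter_upwards [Measure.ae_ne volume a, Measure.ae_ne volume b] with t h h' using ⟨h, h'⟩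
  filter_upwards [h1, h2] with t h1 h2 ht
  rw [uIcc_of_le hab] at h1
  refine ((h1 ht a ha).const_add (u a)).congr_of_eventuallyEq ?_
  filter_upwards [Icc_mem_nhds (lt_of_le_of_ne ht.1 h2.1.symm) (lt_of_le_of_ne ht.2 h2.2)] with s hs
  exact h.eq_add s hs

/-- A function whose increments are dominated by those of a primitive is constant if its derivative
vanishes almost everywhere. -/
theorem eq_of_dist_le_integral {u : ℝ → E} {m : ℝ → ℝ} (hab : a ≤ b)
    (hm : IntegrableOn m (Icc a b))
    (hd : ∀ s ∈ Icc a b, ∀ t ∈ Icc a b, dist (u s) (u t) ≤ |∫ τ in s..t, m τ|)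
    (h0 : ∀ᵐ t, t ∈ Icc a b → HasDerivAt u 0 t) : ∀ t ∈ Icc a b, u t = u a := by
  have hint : IntervalIntegrable m volume a b :=
    (hm.mono_set (by rw [uIcc_of_le hab])).intervalIntegrable
  have hac := hint.absolutelyContinuousOnInterval_intervalIntegral (c := a) left_mem_uIcc
  -- Absolute continuity is inherited from the indefinite integral of `m`, whose increments dominate
  -- those of `u`.
  have hu : AbsolutelyContinuousOnInterval u a b := by
    refine squeeze_zero' (Eventually.of_forall fun _ => Finset.sum_nonneg fun _ _ => dist_nonneg)
      ?_ hac
    filter_upwards [mem_inf_of_right (mem_principal_self _)] with I hI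
    refine Finset.sum_le_sum fun i hi => ?_
    have h1 := hI.1 i hi
    rw [uIcc_of_le hab] at h1
    have hsub : ∀ {c d : ℝ}, c ∈ Icc a b → d ∈ Icc a b → IntervalIntegrable m volume c d :=
      fun hc hd => (hm.mono_set (uIcc_subset_Icc hc hd)).intervalIntegrable
    have ha : a ∈ Icc a b := ⟨le_rfl, hab⟩
    refine (hd _ h1.1 _ h1.2).trans_eq ?_
    rw [dist_comm, Real.dist_eq, intervalIntegral.integral_interval_sub_left (hsub ha h1.2)
      (hsub ha h1.1)]
  obtain ⟨C, hC⟩ := hu.const_of_ae_hasDerivAt_zero (by rwa [uIcc_of_le hab])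
  rw [uIcc_of_le hab] at hC
  intro t ht
  rw [hC t ht, hC a ⟨le_rfl, hab⟩]

theorem integrableOn_bilin [CompleteSpace E] (L : E →L[ℝ] F →L[ℝ] G)
    (hu : IsPrimitive a b u g) (hk : IntegrableOn k (Icc a b)) :
    IntegrableOn (fun t => L (u t) (k t)) (Icc a b) := by
  obtain ⟨C, -, hC⟩ := hu.exists_bound
  exact L.integrable_of_bilin_of_bdd_left C hu.aestronglyMeasurable
    ((ae_restrict_iff' measurableSet_Icc).2 (Eventually.of_forall hC)) hk

/-- Product rule for primitives. -/
theorem bilin [CompleteSpace E] [CompleteSpace F] [CompleteSpace G] (L : E →L[ℝ] F →L[ℝ] G)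
    (hu : IsPrimitive a b u g) (hv : IsPrimitive a b v k) :
    IsPrimitive a b (fun t => L (u t) (v t)) (fun t => L (u t) (k t) + L (g t) (v t)) := by
  have i1 := integrableOn_bilin L hu hv.integrableOn
  have i2 : IntegrableOn (fun t => L (g t) (v t)) (Icc a b) :=
    integrableOn_bilin L.flip hv hu.integrableOn
  have i3 := i1.add i2
  refine ⟨i3, fun t ht => ?_⟩
  have hab : a ≤ b := ht.1.trans ht.2
  have ha : a ∈ Icc a b := ⟨le_rfl, hab⟩
  obtain ⟨Cu, hCu0, hCu⟩ := hu.exists_bound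
  obtain ⟨Cv, hCv0, hCv⟩ := hv.exists_bound
  set q : ℝ → G := fun t => L (u t) (k t) + L (g t) (v t) with hq
  have hqi : ∀ {s t}, s ∈ Icc a b → t ∈ Icc a b → IntervalIntegrable q volume s t :=
    fun hs ht => (IntegrableOn.mono_set i3 (uIcc_subset_Icc hs ht)).intervalIntegrable
  -- It suffices that `P` is constant. Its increment over `[s, t]` is `L (u t - u s) (v t) + L (u s)
  -- (v t - v s) - ∫ q`, dominated by `∫ m`, and its derivative vanishes almost everywhere by the
  -- pointwise product rule.
  let P : ℝ → G := fun t => L (u t) (v t) - ∫ τ in a..t, q τ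
  let m : ℝ → ℝ := fun t => ‖L‖ * Cv * ‖g t‖ + ‖L‖ * Cu * ‖k t‖ + ‖q t‖
  have mi : IntegrableOn m (Icc a b) :=
    ((hu.integrableOn.norm.const_mul _).add (hv.integrableOn.norm.const_mul _)).add i3.norm
  have hmain := eq_of_dist_le_integral (u := P) hab mi ?_ ?_ t ht
  · have : P a = L (u a) (v a) := by simp [P]
    rw [this, sub_eq_iff_eq_add] at hmain
    exact hmain
  · have wlog_le : ∀ s ∈ Icc a b, ∀ t ∈ Icc a b, s ≤ t →
        dist (P s) (P t) ≤ ∫ τ in s..t, m τ := by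
      intro s hs t ht hst
      have e1 : P t - P s = L (u t - u s) (v t) + L (u s) (v t - v s) - ∫ τ in s..t, q τ := by
        rw [← intervalIntegral.integral_interval_sub_left (hqi ha ht) (hqi ha hs)]
        simp only [P, map_sub, _root_.sub_apply]
        abel
      have ng : IntervalIntegrable (fun τ => ‖g τ‖) volume s t := (hu.intervalIntegrable hs ht).norm
      have nk : IntervalIntegrable (fun τ => ‖k τ‖) volume s t := (hv.intervalIntegrable hs ht).norm
      have e2 : ∫ τ in s..t, m τ = ‖L‖ * Cv * (∫ τ in s..t, ‖g τ‖) +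
          ‖L‖ * Cu * (∫ τ in s..t, ‖k τ‖) + ∫ τ in s..t, ‖q τ‖ := by
        rw [intervalIntegral.integral_add ((ng.const_mul _).add (nk.const_mul _)) (hqi hs ht).norm,
          intervalIntegral.integral_add (ng.const_mul _) (nk.const_mul _),
          intervalIntegral.integral_const_mul, intervalIntegral.integral_const_mul]
      rw [dist_comm, dist_eq_norm, e1, e2]
      refine (norm_sub_le _ _).trans (add_le_add ((norm_add_le _ _).trans (add_le_add ?_ ?_))
        (intervalIntegral.norm_integral_le_integral_norm hst))
      · rw [hu.sub_eq hs ht]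
        refine (L.le_opNorm₂ _ _).trans ?_
        have := intervalIntegral.norm_integral_le_integral_norm (f := g) (μ := volume) hst
        rw [mul_right_comm ‖L‖ Cv]
        exact mul_le_mul (by gcongr) (hCv t ht) (norm_nonneg (v t))
          (mul_nonneg (norm_nonneg L) ((norm_nonneg _).trans this))
      · rw [hv.sub_eq hs ht]
        refine (L.le_opNorm₂ _ _).trans ?_
        have := intervalIntegral.norm_integral_le_integral_norm (f := k) (μ := volume) hst
        exact mul_le_mul (by gcongr; exact hCu s hs) this (norm_nonneg _) (by positivity)
    intro s hs t ht
    rcases le_total s t with h | h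
    · exact (wlog_le s hs t ht h).trans (le_abs_self _)
    · rw [dist_comm, intervalIntegral.integral_symm, abs_neg]
      exact (wlog_le t ht s hs h).trans (le_abs_self _)
  · have h1 := ((hqi ha ⟨hab, le_rfl⟩).ae_hasDerivAt_integral)
    rw [uIcc_of_le hab] at h1
    filter_upwards [hu.ae_hasDerivAt, hv.ae_hasDerivAt, h1] with t h1 h2 h3 ht
    have h4 := (L.hasFDerivAt_of_bilinear (h1 ht).hasFDerivAt (h2 ht).hasFDerivAt).hasDerivAt.sub
      (h3 ht a ha)
    refine h4.congr_deriv ?_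
    simp [hq]

end IsPrimitive

end Generic

/-! ### Translations, difference quotients and multiplications on `L²(ℝⁿ)` -/

section SpaceL2

variable {n : ℕ}

theorem HZero.norm_sq_eq (u : HZero n) : ‖u‖ ^ 2 = ∫ x, (u x) ^ 2 := by
  rw [← real_inner_self_eq_norm_sq, L2.inner_def]
  simp [sq]

theorem HZero.inner_eq (u v : HZero n) : inner ℝ u v = ∫ x, u x * v x := by
  rw [L2.inner_def]
  simp [mul_comm]

/-- Dominated convergence in `L²`. -/
theorem HZero.tendsto_of_dominated {ι : Type*} {l : Filter ι} [l.IsCountablyGenerated]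
    {F : ι → HZero n} {f : HZero n} {Fr : ι → StateSpace n → ℝ} {fr g : StateSpace n → ℝ}
    (hF : ∀ k, F k =ᵐ[volume] Fr k) (hf : f =ᵐ[volume] fr) (hg : MemLp g 2)
    (hb : ∀ᶠ k in l, ∀ᵐ x, |Fr k x| ≤ g x)
    (hlim : ∀ᵐ x, Tendsto (fun k => Fr k x) l (𝓝 (fr x))) (hfr : ∀ᵐ x, |fr x| ≤ g x) :
    Tendsto F l (𝓝 f) := by
  rw [tendsto_iff_norm_sub_tendsto_zero]
  have h1 : Tendsto (fun k => ‖F k - f‖ ^ 2) l (𝓝 0) := by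
    have h2 : ∀ k, ‖F k - f‖ ^ 2 = ∫ x, (Fr k x - fr x) ^ 2 := fun k => by
      rw [HZero.norm_sq_eq]
      refine integral_congr_ae ?_
      filter_upwards [hF k, hf, Lp.coeFn_sub (F k) f] with x h1 h2 h3
      rw [h3, Pi.sub_apply, h1, h2]
    simp_rw [h2]
    have h3 : (0 : ℝ) = ∫ _x : StateSpace n, (0 : ℝ) := by simp
    rw [h3]
    refine tendsto_integral_filter_of_dominated_convergence (fun x => 4 * g x ^ 2) ?_ ?_ ?_ ?_
    · refine Eventually.of_forall fun k => ?_
      have m1 := (Lp.aestronglyMeasurable (F k)).congr (hF k)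
      have m2 := (Lp.aestronglyMeasurable f).congr hf
      exact (m1.sub m2).pow 2
    · filter_upwards [hb] with k hk
      filter_upwards [hk, hfr] with x h1 h2
      rw [Real.norm_eq_abs, abs_of_nonneg (sq_nonneg _)]
      rw [abs_le] at h1 h2
      nlinarith
    · exact hg.integrable_sq.const_mul 4
    · filter_upwards [hlim] with x hx
      simpa using (hx.sub_const (fr x)).pow 2
  have h2 := h1.sqrt
  simpa using h2

/-- Translation by `a` on `L²(ℝⁿ)`. -/
noncomputable def shift (a : StateSpace n) : HZero n →ₗᵢ[ℝ] HZero n :=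
  Lp.compMeasurePreservingₗᵢ ℝ (fun x => x + a) (measurePreserving_add_right volume a)

theorem coeFn_shift (a : StateSpace n) (u : HZero n) :
    shift a u =ᵐ[volume] fun x => u (x + a) :=
  Lp.coeFn_compMeasurePreserving u (measurePreserving_add_right volume a)

theorem ae_shift {p : StateSpace n → Prop} (a : StateSpace n) (h : ∀ᵐ x, p x) :
    ∀ᵐ x, p (x + a) :=
  (measurePreserving_add_right volume a).quasiMeasurePreserving.ae h

theorem shift_congr {u : HZero n} {v : StateSpace n → ℝ} (a : StateSpace n)
    (h : u =ᵐ[volume] v) : shift a u =ᵐ[volume] fun x => v (x + a) := by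
  filter_upwards [coeFn_shift a u, ae_shift a h] with x h1 h2
  rw [h1, h2]

theorem shift_shift (a b : StateSpace n) (u : HZero n) :
    shift a (shift b u) = shift (a + b) u := by
  refine Lp.ext ?_
  filter_upwards [shift_congr a (coeFn_shift b u), coeFn_shift (a + b) u] with x h1 h2
  rw [h1, h2, add_assoc]

theorem shift_zero (u : HZero n) : shift 0 u = u := by
  refine Lp.ext ?_
  filter_upwards [coeFn_shift 0 u] with x h1
  rw [h1, add_zero]

theorem inner_shift_left (a : StateSpace n) (u v : HZero n) :
    inner ℝ (shift a u) v = inner ℝ u (shift (-a) v) := by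
  have h := (shift (-a)).inner_map_map (shift a u) v
  rw [shift_shift, neg_add_cancel, shift_zero] at h
  exact h.symm

/-- The centred difference quotient of step `h` in the direction `i`. -/
noncomputable def diffQuot (i : Fin n) (h : ℝ) : HZero n →L[ℝ] HZero n :=
  (2 * h)⁻¹ • ((shift (h • stdVec i)).toContinuousLinearMap -
    (shift (-(h • stdVec i))).toContinuousLinearMap)

theorem diffQuot_apply (i : Fin n) (h : ℝ) (u : HZero n) :
    diffQuot i h u = (2 * h)⁻¹ • (shift (h • stdVec i) u - shift (-(h • stdVec i)) u) := rfl

/-- The adjoint of a translation is the inverse translation, so the centred quotient is exactly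
skew-adjoint; a one-sided quotient would not be. -/
theorem inner_diffQuot_left (i : Fin n) (h : ℝ) (u v : HZero n) :
    inner ℝ (diffQuot i h u) v = -inner ℝ u (diffQuot i h v) := by
  simp only [diffQuot_apply, real_inner_smul_left, real_inner_smul_right, inner_sub_left,
    inner_sub_right, inner_shift_left, neg_neg]
  ring

theorem diffQuot_comm (i j : Fin n) (h : ℝ) (u : HZero n) :
    diffQuot i h (diffQuot j h u) = diffQuot j h (diffQuot i h u) := by
  simp only [diffQuot_apply, map_smul, map_sub, shift_shift]
  rw [add_comm (h • stdVec j) (h • stdVec i), add_comm (h • stdVec j) (-(h • stdVec i)),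
    add_comm (-(h • stdVec j)) (h • stdVec i), add_comm (-(h • stdVec j)) (-(h • stdVec i))]
  simp only [smul_sub]
  abel

/-! ### Multiplication operators -/

open Classical in
/-- Multiplication by an essentially bounded function `b` on `L²(ℝⁿ)` (and `0` if `b` is not
essentially bounded). -/
noncomputable def mulOp (b : StateSpace n → ℝ) : HZero n →L[ℝ] HZero n :=
  if hb : MemLp b ⊤ volume then
    (ContinuousLinearMap.mul ℝ ℝ).holderL volume ⊤ 2 2 (hb.toLp b) else 0

theorem coeFn_mulOp {b : StateSpace n → ℝ} (hb : MemLp b ⊤ volume) (u : HZero n) :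
    mulOp b u =ᵐ[volume] fun x => b x * u x := by
  rw [mulOp, dif_pos hb, ContinuousLinearMap.holderL_apply_apply]
  filter_upwards [(ContinuousLinearMap.mul ℝ ℝ).coeFn_holder (r := 2) (hb.toLp b) u,
    hb.coeFn_toLp] with x h1 h2
  rw [h1, h2]; rfl

theorem norm_le_of_ae_abs_le {u v : HZero n} {C : ℝ} (h : ∀ᵐ x, |u x| ≤ C * |v x|) :
    ‖u‖ ≤ C * ‖v‖ :=
  Lp.norm_le_mul_norm_of_ae_le_mul h

theorem memLp_top_of_abs_le {b : StateSpace n → ℝ} (hm : AEStronglyMeasurable b volume) {K : ℝ}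
    (hK : ∀ x, |b x| ≤ K) : MemLp b ⊤ volume :=
  memLp_top_of_bound hm K (Eventually.of_forall hK)

theorem norm_mulOp_le {b : StateSpace n → ℝ} {K : ℝ} (hK : ∀ x, |b x| ≤ K) (u : HZero n) :
    ‖mulOp b u‖ ≤ K * ‖u‖ := by
  by_cases hb : MemLp b ⊤ volume
  · refine norm_le_of_ae_abs_le ?_
    filter_upwards [coeFn_mulOp hb u] with x hx
    rw [hx, abs_mul]
    gcongr
    exact hK x
  · rw [mulOp, dif_neg hb]
    simpa using mul_nonneg ((abs_nonneg _).trans (hK 0)) (norm_nonneg u)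

theorem inner_mulOp_left (b : StateSpace n → ℝ) (u v : HZero n) :
    inner ℝ (mulOp b u) v = inner ℝ u (mulOp b v) := by
  by_cases hb : MemLp b ⊤ volume
  · rw [HZero.inner_eq, HZero.inner_eq]
    refine integral_congr_ae ?_
    filter_upwards [coeFn_mulOp hb u, coeFn_mulOp hb v] with x h1 h2
    rw [h1, h2]; ring
  · rw [mulOp, dif_neg hb]; simp

/-- Pointwise convergence of bounded multipliers yields only strong operator convergence, by
dominated convergence with majorant `K |u|`. -/
theorem tendsto_mulOp {ι : Type*} {l : Filter ι} [l.IsCountablyGenerated]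
    {β : ι → StateSpace n → ℝ} {b : StateSpace n → ℝ} {K : ℝ}
    (hβ : ∀ k, MemLp (β k) ⊤ volume) (hb : MemLp b ⊤ volume) (hK : ∀ᶠ k in l, ∀ x, |β k x| ≤ K)
    (hbK : ∀ x, |b x| ≤ K) (hlim : ∀ x, Tendsto (fun k => β k x) l (𝓝 (b x))) (u : HZero n) :
    Tendsto (fun k => mulOp (β k) u) l (𝓝 (mulOp b u)) := by
  refine HZero.tendsto_of_dominated (g := fun x => K * |u x|) (fun k => coeFn_mulOp (hβ k) u)
    (coeFn_mulOp hb u) ((Lp.memLp u).abs.const_mul K) ?_ ?_ ?_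
  · filter_upwards [hK] with k hk
    refine Eventually.of_forall fun x => ?_
    rw [abs_mul]
    gcongr
    exact hk x
  · exact Eventually.of_forall fun x => (hlim x).mul_const _
  · refine Eventually.of_forall fun x => ?_
    rw [abs_mul]
    gcongr
    exact hbK x

theorem AEStronglyMeasurable.comp_add_right {b : StateSpace n → ℝ}
    (hm : AEStronglyMeasurable b volume) (a : StateSpace n) :
    AEStronglyMeasurable (fun x => b (x + a)) volume :=
  hm.comp_measurePreserving (measurePreserving_add_right volume a)

/-- The commutator of a difference quotient with a multiplication. -/
theorem diffQuot_mulOp_sub {b : StateSpace n → ℝ} (hm : AEStronglyMeasurable b volume) {K L : ℝ}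
    (hK : ∀ x, |b x| ≤ K) {i : Fin n} (hL : ∀ x (t : ℝ), |b (x + t • stdVec i) - b x| ≤ L * |t|)
    {h : ℝ} (hh : h ≠ 0) (u : HZero n) :
    diffQuot i h (mulOp b u) - mulOp b (diffQuot i h u) =
      (2⁻¹ : ℝ) • (mulOp (fun x => h⁻¹ * (b (x + h • stdVec i) - b x)) (shift (h • stdVec i) u) +
        mulOp (fun x => (-h)⁻¹ * (b (x + (-h) • stdVec i) - b x)) (shift (-(h • stdVec i)) u)) := by
  have hb := memLp_top_of_abs_le hm hK
  have hq : ∀ h : ℝ, h ≠ 0 →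
      MemLp (fun x => h⁻¹ * (b (x + h • stdVec i) - b x)) ⊤ volume := fun h hh => by
    refine memLp_top_of_abs_le (K := L)
      (((AEStronglyMeasurable.comp_add_right hm _).sub hm).const_mul _) fun x => ?_
    rw [abs_mul, abs_inv, inv_mul_le_iff₀ (abs_pos.2 hh), mul_comm]
    exact hL x h
  have e1 : ∀ v : HZero n, diffQuot i h v =ᵐ[volume]
      fun x => (2 * h)⁻¹ * (v (x + h • stdVec i) - v (x + -(h • stdVec i))) := fun v => by
    rw [diffQuot_apply]
    filter_upwards [Lp.coeFn_smul (2 * h)⁻¹ (shift (h • stdVec i) v - shift (-(h • stdVec i)) v),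
      Lp.coeFn_sub (shift (h • stdVec i) v) (shift (-(h • stdVec i)) v),
      coeFn_shift (h • stdVec i) v, coeFn_shift (-(h • stdVec i)) v] with x h1 h2 h3 h4
    rw [h1, Pi.smul_apply, h2, Pi.sub_apply, h3, h4, smul_eq_mul]
  refine Lp.ext ?_
  set P := mulOp (fun x => h⁻¹ * (b (x + h • stdVec i) - b x)) (shift (h • stdVec i) u)
  set Q := mulOp (fun x => (-h)⁻¹ * (b (x + (-h) • stdVec i) - b x)) (shift (-(h • stdVec i)) u)
  filter_upwards [Lp.coeFn_sub (diffQuot i h (mulOp b u)) (mulOp b (diffQuot i h u)),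
    Lp.coeFn_smul (2⁻¹ : ℝ) (P + Q), Lp.coeFn_add P Q, coeFn_mulOp (hq h hh) (shift (h • stdVec i) u),
    coeFn_mulOp (hq (-h) (neg_ne_zero.2 hh)) (shift (-(h • stdVec i)) u),
    coeFn_shift (h • stdVec i) u, coeFn_shift (-(h • stdVec i)) u, e1 u, e1 (mulOp b u),
    coeFn_mulOp hb (diffQuot i h u), ae_shift (h • stdVec i) (coeFn_mulOp hb u),
    ae_shift (-(h • stdVec i)) (coeFn_mulOp hb u)] with x h1 h2 h3 h4 h5 h6 h7 h8 h9 h10 h11 h12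
  rw [h1, h2, Pi.sub_apply, Pi.smul_apply, h3, Pi.add_apply, h4, h5, h6, h7, h9, h10, h8, h11, h12,
    smul_eq_mul, neg_smul]
  field_simp
  ring

/-- The commutator is the mean of two multiplications by one-sided difference quotients of `b`, each
bounded by `L`, composed with isometric translations. Its bound is therefore independent of the step
`h`. -/
theorem norm_diffQuot_mulOp_sub_le {b : StateSpace n → ℝ} (hm : AEStronglyMeasurable b volume)
    {K L : ℝ} (hK : ∀ x, |b x| ≤ K) {i : Fin n}
    (hL : ∀ x (t : ℝ), |b (x + t • stdVec i) - b x| ≤ L * |t|)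
    {h : ℝ} (hh : h ≠ 0) (u : HZero n) :
    ‖diffQuot i h (mulOp b u) - mulOp b (diffQuot i h u)‖ ≤ L * ‖u‖ := by
  rw [diffQuot_mulOp_sub hm hK hL hh]
  have hq : ∀ h : ℝ, h ≠ 0 → ∀ x, |h⁻¹ * (b (x + h • stdVec i) - b x)| ≤ L := fun h hh x => by
    rw [abs_mul, abs_inv, inv_mul_le_iff₀ (abs_pos.2 hh), mul_comm]
    exact hL x h
  have h1 := norm_mulOp_le (hq h hh) (shift (h • stdVec i) u)
  have h2 := norm_mulOp_le (hq (-h) (neg_ne_zero.2 hh)) (shift (-(h • stdVec i)) u)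
  rw [LinearIsometry.norm_map] at h1 h2
  rw [norm_smul, Real.norm_eq_abs, abs_of_pos (by norm_num : (0 : ℝ) < 2⁻¹)]
  have h3 := (norm_add_le _ _).trans (add_le_add h1 h2)
  linarith

end SpaceL2

/-! ### Weak derivatives through difference quotients -/

section WeakDerivatives

variable {n : ℕ}

instance HZero.secondCountableTopology : SecondCountableTopology (HZero n) :=
  haveI : Fact ((2 : ENNReal) ≠ ⊤) := ⟨by simp⟩
  Lp.SecondCountableTopology

/-- Smooth functions with compact support. -/
structure IsTest (ψ : StateSpace n → ℝ) : Prop where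
  contDiff : ContDiff ℝ ∞ ψ
  hasCompactSupport : HasCompactSupport ψ

namespace IsTest

variable {ψ : StateSpace n → ℝ}

theorem memLp (h : IsTest ψ) : MemLp ψ 2 :=
  h.contDiff.continuous.memLp_of_hasCompactSupport h.hasCompactSupport

/-- The class in `L²` of a test function. -/
noncomputable def toH (h : IsTest ψ) : HZero n := h.memLp.toLp ψ

theorem coeFn_toH (h : IsTest ψ) : h.toH =ᵐ[volume] ψ := h.memLp.coeFn_toLp

theorem pderiv (h : IsTest ψ) (i : Fin n) : IsTest fun x => fderiv ℝ ψ x (stdVec i) where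
  contDiff := (h.contDiff.fderiv_right (m := ∞) (by simp)).clm_apply contDiff_const
  hasCompactSupport := h.hasCompactSupport.fderiv_apply ℝ (stdVec i)

theorem add_smul_sub_le (h : IsTest ψ) :
    ∃ C, ∀ x i (t : ℝ), |ψ (x + t • stdVec i) - ψ x| ≤ C * |t| := by
  obtain ⟨C, hC⟩ := ContDiff.lipschitzWith_of_hasCompactSupport h.hasCompactSupport
    h.contDiff (by simp)
  refine ⟨C, fun x i t => ?_⟩
  have := hC.norm_sub_le (x + t • stdVec i) x
  simpa [norm_smul] using this

/-- Translation of test functions is differentiable in `L²`. -/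
theorem hasDerivAt_shift_zero (h : IsTest ψ) (i : Fin n) :
    HasDerivAt (fun t : ℝ => shift (t • stdVec i) h.toH) (h.pderiv i).toH 0 := by
  rw [hasDerivAt_iff_tendsto_slope]
  obtain ⟨C, hC⟩ := h.add_smul_sub_le
  have hC0 : ∀ x, |fderiv ℝ ψ x (stdVec i)| ≤ C ∧
      Tendsto (fun t : ℝ => t⁻¹ * (ψ (x + t • stdVec i) - ψ x)) (𝓝[≠] 0)
        (𝓝 (fderiv ℝ ψ x (stdVec i))) := by
    intro x
    have h1 : HasDerivAt (fun t : ℝ => ψ (x + t • stdVec i)) (fderiv ℝ ψ x (stdVec i)) 0 :=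
      ((h.contDiff.differentiable (by simp) x).hasFDerivAt).hasLineDerivAt (stdVec i)
    rw [hasDerivAt_iff_tendsto_slope] at h1
    have h2 : Tendsto (fun t : ℝ => t⁻¹ * (ψ (x + t • stdVec i) - ψ x)) (𝓝[≠] 0)
        (𝓝 (fderiv ℝ ψ x (stdVec i))) := by
      refine h1.congr fun t => ?_
      simp [slope]
    refine ⟨le_of_tendsto h2.abs ?_, h2⟩
    filter_upwards [self_mem_nhdsWithin] with t ht
    rw [abs_mul, abs_inv, inv_mul_le_iff₀ (abs_pos.2 ht), mul_comm]
    exact hC x i t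
  -- For `|t| ≤ 1` all the quotients vanish outside this compact set, so `C` times its indicator is
  -- a square-integrable majorant.
  set T := Metric.cthickening 1 (tsupport ψ)
  have hT : IsCompact T := h.hasCompactSupport.cthickening
  have hsub : ∀ x, x ∉ T → ∀ t : ℝ, |t| ≤ 1 → ψ (x + t • stdVec i) = 0 := by
    intro x hx t ht
    by_contra hne
    refine hx (Metric.mem_cthickening_of_dist_le x (x + t • stdVec i) 1 _
      (subset_tsupport _ hne) ?_)
    simpa [norm_smul] using ht
  refine HZero.tendsto_of_dominated (g := T.indicator fun _ => C)
    (Fr := fun t x => t⁻¹ * (ψ (x + t • stdVec i) - ψ x)) (fun t => ?_) (h.pderiv i).coeFn_toH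
    (memLp_indicator_const 2 hT.measurableSet C (Or.inr hT.measure_lt_top.ne)) ?_
    (Eventually.of_forall fun x => (hC0 x).2) (Eventually.of_forall fun x => ?_)
  · simp only [slope, vsub_eq_sub, sub_zero, zero_smul, shift_zero]
    filter_upwards [Lp.coeFn_smul t⁻¹ (shift (t • stdVec i) h.toH - h.toH),
      Lp.coeFn_sub (shift (t • stdVec i) h.toH) h.toH, shift_congr (t • stdVec i) h.coeFn_toH,
      h.coeFn_toH] with x h1 h2 h3 h4
    rw [h1, Pi.smul_apply, h2, Pi.sub_apply, h3, h4, smul_eq_mul]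
  · have h1 : ∀ᶠ t : ℝ in 𝓝[≠] 0, |t| ≤ 1 := by
      refine nhdsWithin_le_nhds ?_
      filter_upwards [Metric.closedBall_mem_nhds (0 : ℝ) one_pos] with t ht
      simpa using ht
    filter_upwards [h1, self_mem_nhdsWithin] with t ht ht0
    refine Eventually.of_forall fun x => ?_
    by_cases hx : x ∈ T
    · rw [indicator_of_mem hx, abs_mul, abs_inv, inv_mul_le_iff₀ (abs_pos.2 ht0), mul_comm]
      exact hC x i t
    · have := hsub x hx 0 (by simp)
      rw [zero_smul, add_zero] at this
      rw [indicator_of_notMem hx, hsub x hx t ht, this]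
      simp
  · by_cases hx : x ∈ T
    · rw [indicator_of_mem hx]; exact (hC0 x).1
    · rw [indicator_of_notMem hx, image_eq_zero_of_notMem_tsupport
        (f := fun x => fderiv ℝ ψ x (stdVec i)), abs_zero]
      intro hmem
      exact hx (Metric.self_subset_cthickening _ (tsupport_fderiv_apply_subset ℝ (stdVec i) hmem))

theorem hasDerivAt_shift (h : IsTest ψ) (i : Fin n) (s : ℝ) :
    HasDerivAt (fun t : ℝ => shift (t • stdVec i) h.toH)
      (shift (s • stdVec i) (h.pderiv i).toH) s := by
  have h1 : HasDerivAt (fun t : ℝ => shift (t • stdVec i) h.toH) (h.pderiv i).toH (s - s) := by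
    rw [sub_self]; exact h.hasDerivAt_shift_zero i
  have h2 := ((shift (s • stdVec i)).toContinuousLinearMap.hasFDerivAt.comp_hasDerivAt s
    (h1.comp_sub_const s s))
  refine h2.congr_of_eventuallyEq (Eventually.of_forall fun t => ?_)
  simp only [Function.comp, LinearIsometry.coe_toContinuousLinearMap, shift_shift, ← add_smul,
    add_sub_cancel]

end IsTest

/-- The set of classes of test functions is dense in `L²`. -/
theorem dense_range_toH : Dense {u : HZero n | ∃ (ψ : StateSpace n → ℝ) (h : IsTest ψ), u = h.toH} := by
  refine (Lp.dense_hasCompactSupport_contDiff (F := ℝ) (μ := (volume : Measure (StateSpace n)))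
    (p := 2) (by simp)).mono ?_
  rintro u ⟨ψ, hu, h1, h2⟩
  exact ⟨ψ, ⟨h2, h1⟩, Lp.ext (hu.trans (IsTest.coeFn_toH _).symm)⟩

/-- Local integrability is automatic in `L²`, so weak differentiability becomes a family of closed
linear conditions on the pair `(u, w)`. -/
theorem hasWeakPartial_iff {i : Fin n} {u w : HZero n} :
    HasWeakPartial i u w ↔ ∀ (ψ : StateSpace n → ℝ) (h : IsTest ψ),
      inner ℝ u (h.pderiv i).toH = -inner ℝ w h.toH := by
  have hloc : ∀ v : HZero n, LocallyIntegrable v := fun v =>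
    (Lp.memLp v).locallyIntegrable (by norm_num)
  have h1 : ∀ (v : HZero n) (ψ : StateSpace n → ℝ) (h : IsTest ψ),
      inner ℝ v h.toH = ∫ x, v x * ψ x := fun v ψ h => by
    rw [HZero.inner_eq]
    refine integral_congr_ae ?_
    filter_upwards [h.coeFn_toH] with x hx
    rw [hx]
  constructor
  · intro h ψ hψ
    rw [h1, h1]
    exact h.2.2 ψ hψ.contDiff hψ.hasCompactSupport
  · intro h
    refine ⟨hloc u, hloc w, fun ψ hc hs => ?_⟩
    have := h ψ ⟨hc, hs⟩
    rwa [h1, h1] at this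

theorem HasWeakPartial.congr {i : Fin n} {u u' w w' : StateSpace n → ℝ} (h : HasWeakPartial i u w)
    (hu : u =ᵐ[volume] u') (hw : w =ᵐ[volume] w') : HasWeakPartial i u' w' := by
  refine ⟨h.1.congr hu, h.2.1.congr hw, fun ψ h1 h2 => ?_⟩
  rw [integral_congr_ae (g := fun x => u x * fderiv ℝ ψ x (stdVec i)), h.2.2 ψ h1 h2,
    integral_congr_ae (g := fun x => w' x * ψ x)]
  · filter_upwards [hw] with x hx
    rw [hx]
  · filter_upwards [hu] with x hx
    rw [hx]

theorem HasWeakPartial.add {i : Fin n} {u u' w w' : HZero n} (h : HasWeakPartial i u w)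
    (h' : HasWeakPartial i u' w') : HasWeakPartial i (u + u' : HZero n) (w + w' : HZero n) := by
  rw [hasWeakPartial_iff] at *
  intro ψ hψ
  rw [inner_add_left, inner_add_left, h _ hψ, h' _ hψ, neg_add]

theorem HasWeakPartial.smul {i : Fin n} {u w : HZero n} (h : HasWeakPartial i u w) (c : ℝ) :
    HasWeakPartial i (c • u : HZero n) (c • w : HZero n) := by
  rw [hasWeakPartial_iff] at *
  intro ψ hψ
  rw [real_inner_smul_left, real_inner_smul_left, h _ hψ, mul_neg]

theorem HasWeakPartial.sub {i : Fin n} {u u' w w' : HZero n} (h : HasWeakPartial i u w)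
    (h' : HasWeakPartial i u' w') : HasWeakPartial i (u - u' : HZero n) (w - w' : HZero n) := by
  rw [hasWeakPartial_iff] at *
  intro ψ hψ
  rw [inner_sub_left, inner_sub_left, h _ hψ, h' _ hψ]; ring

/-- The step of the `k`-th difference quotient. -/
noncomputable def step (k : ℕ) : ℝ := 1 / ((k : ℝ) + 1)

theorem step_pos (k : ℕ) : 0 < step k := Nat.one_div_pos_of_nat

theorem tendsto_step : Tendsto step atTop (𝓝[≠] 0) :=
  tendsto_nhdsWithin_iff.2 ⟨tendsto_one_div_add_atTop_nhds_zero_nat,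
    Eventually.of_forall fun k => (step_pos k).ne'⟩

theorem tendsto_neg_step : Tendsto (fun k => -step k) atTop (𝓝[≠] 0) :=
  tendsto_nhdsWithin_iff.2 ⟨by simpa using (tendsto_step.mono_right nhdsWithin_le_nhds).neg,
    Eventually.of_forall fun k => neg_ne_zero.2 (step_pos k).ne'⟩

theorem IsTest.tendsto_diffQuot {ψ : StateSpace n → ℝ} (h : IsTest ψ) (i : Fin n) :
    Tendsto (fun k => diffQuot i (step k) h.toH) atTop (𝓝 (h.pderiv i).toH) := by
  have h1 := (hasDerivAt_iff_tendsto_slope.1 (h.hasDerivAt_shift_zero i))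
  -- The centred quotient is the mean of the slopes with increments `step k` and `-step k`.
  have h2 := ((h1.comp tendsto_step).add (h1.comp tendsto_neg_step)).const_smul (2⁻¹ : ℝ)
  rw [← two_smul ℝ, smul_smul, inv_mul_cancel₀ two_ne_zero, one_smul] at h2
  refine h2.congr fun k => ?_
  have := (step_pos k).ne'
  simp only [Function.comp, slope, vsub_eq_sub, sub_zero, diffQuot_apply, neg_smul, mul_inv, inv_neg]
  module

/-- Weak convergence can be tested on a dense set along bounded sequences. -/
theorem tendsto_inner_of_dense {H : Type*} [NormedAddCommGroup H] [InnerProductSpace ℝ H]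
    {x : ℕ → H} {z : H} {R : ℝ} (hR : ∀ k, ‖x k‖ ≤ R) {S : Set H} (hS : Dense S)
    (h : ∀ y ∈ S, Tendsto (fun k => inner ℝ (x k) y) atTop (𝓝 (inner ℝ z y))) (y : H) :
    Tendsto (fun k => inner ℝ (x k) y) atTop (𝓝 (inner ℝ z y)) := by
  rw [Metric.tendsto_atTop]
  intro ε hε
  have hR0 : 0 ≤ R := (norm_nonneg _).trans (hR 0)
  set Q := R + ‖z‖ + 1 with hQ
  have hQ0 : 0 < Q := by positivity
  obtain ⟨y', hy', hyy⟩ := Metric.mem_closure_iff.1 (hS y) (ε / (2 * Q)) (by positivity)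
  obtain ⟨N, hN⟩ := Metric.tendsto_atTop.1 (h y' hy') (ε / 2) (by positivity)
  refine ⟨N, fun k hk => ?_⟩
  have h1 := hN k hk
  rw [dist_eq_norm] at hyy
  rw [Real.dist_eq] at h1 ⊢
  have h2 : inner ℝ (x k) y - inner ℝ z y =
      (inner ℝ (x k) y' - inner ℝ z y') + (inner ℝ (x k) (y - y') - inner ℝ z (y - y')) := by
    rw [inner_sub_right, inner_sub_right]; ring
  have h3 : |inner ℝ (x k) (y - y')| ≤ R * ‖y - y'‖ :=
    (abs_real_inner_le_norm _ _).trans (by gcongr; exact hR k)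
  have h4 : |inner ℝ z (y - y')| ≤ ‖z‖ * ‖y - y'‖ := abs_real_inner_le_norm _ _
  have h5 : Q * ‖y - y'‖ < ε / 2 := by
    rw [lt_div_iff₀ (by positivity)] at hyy
    linarith
  have h6 : (R + ‖z‖) * ‖y - y'‖ ≤ Q * ‖y - y'‖ := by gcongr; linarith
  rw [h2]
  rw [abs_lt] at *
  rw [abs_le] at h3 h4
  constructor <;> nlinarith

/-- Argue by duality: for a test function `ψ`, the function `s ↦ (u, shift_s ψ)` has derivative
`-(w, shift_s ψ)`, of size at most `‖w‖ ‖ψ‖`. The mean value inequality on `[-t, t]` bounds the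
quotient against `ψ`, and test functions are dense. -/
theorem HasWeakPartial.norm_diffQuot_le {i : Fin n} {u w : HZero n} (h : HasWeakPartial i u w)
    {t : ℝ} (ht : 0 < t) : ‖diffQuot i t u‖ ≤ ‖w‖ := by
  rw [hasWeakPartial_iff] at h
  have htest : ∀ (ψ : StateSpace n → ℝ) (hψ : IsTest ψ),
      |inner ℝ (diffQuot i t u) hψ.toH| ≤ ‖w‖ * ‖hψ.toH‖ := by
    intro ψ hψ
    have hshift : ∀ s : ℝ, inner ℝ u (shift (s • stdVec i) (hψ.pderiv i).toH) =
        -inner ℝ w (shift (s • stdVec i) hψ.toH) := by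
      intro s
      have hτ : IsTest fun x => ψ (x + s • stdVec i) :=
        ⟨hψ.contDiff.comp (contDiff_id.add contDiff_const),
          hψ.hasCompactSupport.comp_homeomorph (Homeomorph.addRight _)⟩
      have e1 : hτ.toH = shift (s • stdVec i) hψ.toH :=
        Lp.ext (hτ.coeFn_toH.trans (shift_congr _ hψ.coeFn_toH).symm)
      have e2 : (hτ.pderiv i).toH = shift (s • stdVec i) (hψ.pderiv i).toH := by
        refine Lp.ext ((hτ.pderiv i).coeFn_toH.trans ?_)
        filter_upwards [shift_congr (s • stdVec i) (hψ.pderiv i).coeFn_toH] with x hx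
        rw [hx, fderiv_comp_add_right]
      rw [← e1, ← e2]
      exact h _ hτ
    have hder : ∀ s : ℝ, HasDerivAt (fun s : ℝ => inner ℝ u (shift (s • stdVec i) hψ.toH))
        (-inner ℝ w (shift (s • stdVec i) hψ.toH)) s := fun s => by
      rw [← hshift]
      exact (innerSL ℝ u).hasFDerivAt.comp_hasDerivAt s (hψ.hasDerivAt_shift i s)
    have hmv := (convex_univ (𝕜 := ℝ) (E := ℝ)).norm_image_sub_le_of_norm_hasDerivWithin_le
      (C := ‖w‖ * ‖hψ.toH‖)
      (fun s _ => (hder s).hasDerivWithinAt) (fun s _ => by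
        rw [norm_neg]
        refine (norm_inner_le_norm _ _).trans_eq ?_
        rw [LinearIsometry.norm_map]) (mem_univ (-t)) (mem_univ t)
    rw [inner_diffQuot_left, diffQuot_apply, real_inner_smul_right, inner_sub_right, abs_neg,
      abs_mul, abs_inv, abs_of_pos (by positivity : 0 < 2 * t), inv_mul_le_iff₀ (by positivity)]
    rw [neg_smul, sub_neg_eq_add, Real.norm_eq_abs, Real.norm_eq_abs,
      abs_of_pos (by positivity : 0 < t + t)] at hmv
    linarith
  have hall : ∀ y : HZero n, |inner ℝ (diffQuot i t u) y| ≤ ‖w‖ * ‖y‖ := by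
    intro y
    refine dense_range_toH.induction (P := fun y => |inner ℝ (diffQuot i t u) y| ≤ ‖w‖ * ‖y‖)
      ?_ (isClosed_le (by fun_prop) (by fun_prop)) y
    rintro _ ⟨ψ, hψ, rfl⟩
    exact htest ψ hψ
  have h1 := hall (diffQuot i t u)
  rw [real_inner_self_eq_norm_sq, abs_of_nonneg (sq_nonneg _)] at h1
  rcases (norm_nonneg (diffQuot i t u)).eq_or_lt with h | h
  · rw [← h]; exact norm_nonneg w
  · refine le_of_mul_le_mul_right ?_ h
    linarith

/-- The quotients are bounded by `‖w‖`, and skewness identifies their limit on test functions. Since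
`y` is an arbitrary element of `L²`, integration by parts and uniqueness reduce to skewness of the
quotients. -/
theorem HasWeakPartial.tendsto_inner_diffQuot {i : Fin n} {u w : HZero n}
    (h : HasWeakPartial i u w) (y : HZero n) :
    Tendsto (fun k => inner ℝ (diffQuot i (step k) u) y) atTop (𝓝 (inner ℝ w y)) := by
  refine tendsto_inner_of_dense (fun k => h.norm_diffQuot_le (step_pos k)) dense_range_toH ?_ y
  rintro _ ⟨ψ, hψ, rfl⟩
  have h1 := (tendsto_const_nhds (x := u)).inner (𝕜 := ℝ) (hψ.tendsto_diffQuot i)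
  rw [hasWeakPartial_iff.1 h ψ hψ] at h1
  have h2 := h1.neg
  rw [neg_neg] at h2
  exact h2.congr fun k => (inner_diffQuot_left i (step k) u _).symm

/-- Integration by parts in `L²`. -/
theorem HasWeakPartial.inner_eq_neg {i : Fin n} {u w u' w' : HZero n} (h : HasWeakPartial i u w)
    (h' : HasWeakPartial i u' w') : inner ℝ w u' = -inner ℝ u w' := by
  refine tendsto_nhds_unique (h.tendsto_inner_diffQuot u') ?_
  have h1 := (h'.tendsto_inner_diffQuot u).neg
  rw [real_inner_comm]
  refine h1.congr fun k => ?_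
  rw [inner_diffQuot_left, real_inner_comm, neg_neg]

theorem HasWeakPartial.unique {i : Fin n} {u w w' : HZero n} (h : HasWeakPartial i u w)
    (h' : HasWeakPartial i u w') : w = w' :=
  ext_inner_right ℝ fun y =>
    tendsto_nhds_unique (h.tendsto_inner_diffQuot y) (h'.tendsto_inner_diffQuot y)

/-- Leibniz rule for the product with a bounded function that has a bounded partial derivative. -/
theorem HasWeakPartial.mulOp {i : Fin n} {u w : HZero n} (h : HasWeakPartial i u w)
    {b db : StateSpace n → ℝ} (hm : AEStronglyMeasurable b volume)
    (hdm : AEStronglyMeasurable db volume) {K L : ℝ} (hK : ∀ x, |b x| ≤ K)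
    (hL : ∀ x (t : ℝ), |b (x + t • stdVec i) - b x| ≤ L * |t|)
    (hd : ∀ x, HasLineDerivAt ℝ b (db x) x (stdVec i)) :
    HasWeakPartial i (mulOp b u) (mulOp b w + mulOp db u : HZero n) := by
  have hslope : ∀ x, Tendsto (fun t : ℝ => t⁻¹ * (b (x + t • stdVec i) - b x)) (𝓝[≠] 0)
      (𝓝 (db x)) := fun x => by
    refine (hasDerivAt_iff_tendsto_slope.1 (hd x)).congr fun t => ?_
    simp [slope]
  have hle : ∀ {t : ℝ}, t ≠ 0 → ∀ x, |t⁻¹ * (b (x + t • stdVec i) - b x)| ≤ L := fun ht x => by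
    rw [abs_mul, abs_inv, inv_mul_le_iff₀ (abs_pos.2 ht), mul_comm]
    exact hL x _
  have hdb : ∀ x, |db x| ≤ L := fun x => by
    refine le_of_tendsto (hslope x).abs ?_
    filter_upwards [self_mem_nhdsWithin] with t ht using hle ht x
  have hdbLp := memLp_top_of_abs_le hdm hdb
  have hq : ∀ {t : ℝ}, t ≠ 0 → MemLp (fun x => t⁻¹ * (b (x + t • stdVec i) - b x)) ⊤ volume :=
    fun ht => memLp_top_of_abs_le
      (((AEStronglyMeasurable.comp_add_right hm _).sub hm).const_mul _) (hle ht)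
  rw [hasWeakPartial_iff]
  intro ψ hψ
  have hlim : ∀ {r : ℕ → ℝ}, Tendsto r atTop (𝓝[≠] 0) → (∀ k, r k ≠ 0) →
      Tendsto (fun k => _root_.mulOp (fun x => (r k)⁻¹ * (b (x + r k • stdVec i) - b x))
        (shift (r k • stdVec i) hψ.toH)) atTop (𝓝 (_root_.mulOp db hψ.toH)) := by
    intro r hr hr0
    have h1 := tendsto_mulOp (fun k => hq (hr0 k)) hdbLp (Eventually.of_forall fun k => hle (hr0 k))
      hdb (fun x => (hslope x).comp hr) hψ.toH
    have h2 : Tendsto (fun k => shift (r k • stdVec i) hψ.toH) atTop (𝓝 hψ.toH) := by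
      have := (hψ.hasDerivAt_shift_zero i).continuousAt.tendsto.comp
        (hr.mono_right nhdsWithin_le_nhds)
      simp only [zero_smul, shift_zero] at this
      exact this
    have h3 : Tendsto (fun k => _root_.mulOp (fun x => (r k)⁻¹ * (b (x + r k • stdVec i) - b x))
        (shift (r k • stdVec i) hψ.toH - hψ.toH)) atTop (𝓝 0) := by
      have h4 := (h2.sub_const hψ.toH).norm.const_mul L
      simp only [sub_self, norm_zero, mul_zero] at h4
      exact squeeze_zero_norm (fun k => norm_mulOp_le (hle (hr0 k)) _) h4
    have h5 := h3.add h1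
    rw [zero_add] at h5
    refine h5.congr fun k => ?_
    rw [← map_add, sub_add_cancel]
  -- Both one-sided quotients of `b` tend pointwise and boundedly to `db`, so the commutator tends
  -- strongly to multiplication by `db`.
  have hcomm : Tendsto (fun k => diffQuot i (step k) (_root_.mulOp b hψ.toH) -
      _root_.mulOp b (diffQuot i (step k) hψ.toH)) atTop (𝓝 (_root_.mulOp db hψ.toH)) := by
    have h1 := ((hlim tendsto_step fun k => (step_pos k).ne').add
      (hlim tendsto_neg_step fun k => neg_ne_zero.2 (step_pos k).ne')).const_smul (2⁻¹ : ℝ)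
    rw [← two_smul ℝ, smul_smul, inv_mul_cancel₀ two_ne_zero, one_smul] at h1
    refine h1.congr fun k => ?_
    rw [diffQuot_mulOp_sub hm hK hL (step_pos k).ne', neg_smul]
  have h1 : Tendsto (fun k => inner ℝ (_root_.mulOp b u) (diffQuot i (step k) hψ.toH)) atTop
      (𝓝 (inner ℝ (_root_.mulOp b u) (hψ.pderiv i).toH)) :=
    tendsto_const_nhds.inner (hψ.tendsto_diffQuot i)
  refine tendsto_nhds_unique h1 ?_
  -- Writing `D` for the quotient, `(b u, D ψ) = -(D u, b ψ) - (u, [D, b] ψ)`. The product `b ψ`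
  -- need not be smooth, so weak convergence against all of `L²` is used.
  have h2 := ((h.tendsto_inner_diffQuot (_root_.mulOp b hψ.toH)).add
    ((tendsto_const_nhds (x := u)).inner (𝕜 := ℝ) hcomm)).neg
  rw [inner_add_left, inner_mulOp_left, inner_mulOp_left]
  refine h2.congr fun k => ?_
  rw [inner_diffQuot_left, inner_sub_right, inner_mulOp_left]
  ring

/-- Weak differentiability can be tested on a countable set of test functions. -/
theorem exists_countable_test (i : Fin n) :
    ∃ Q : Set (HZero n × HZero n), Q.Countable ∧
      (∀ q ∈ Q, ∃ (ψ : StateSpace n → ℝ) (h : IsTest ψ), q = (h.toH, (h.pderiv i).toH)) ∧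
      ∀ u w : HZero n, (∀ q ∈ Q, inner ℝ u q.2 = -inner ℝ w q.1) → HasWeakPartial i u w := by
  let S : Set (HZero n × HZero n) :=
    {q | ∃ (ψ : StateSpace n → ℝ) (h : IsTest ψ), q = (h.toH, (h.pderiv i).toH)}
  -- Density is taken in the set of pairs `(ψ, ∂ᵢψ)`, so functions and derivatives are approximated
  -- together. Countability later allows one null set of times for all tests.
  obtain ⟨Q, hQS, hQc, hSQ⟩ :=
    (TopologicalSpace.IsSeparable.of_separableSpace S).exists_countable_dense_subset
  refine ⟨Q, hQc, fun q hq => hQS hq, fun u w huw => ?_⟩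
  rw [hasWeakPartial_iff]
  intro ψ hψ
  have hcl : IsClosed {q : HZero n × HZero n | inner ℝ u q.2 = -inner ℝ w q.1} :=
    isClosed_eq (by fun_prop) (by fun_prop)
  exact closure_minimal (fun q hq => huw q hq) hcl (hSQ ⟨ψ, hψ, rfl⟩)

end WeakDerivatives

/-! ### Fibrewise operators on `L²` of curves -/

section Lift

variable {α H : Type*} [MeasurableSpace α] {μ : Measure α} [NormedAddCommGroup H]
  [InnerProductSpace ℝ H]

/-- A uniformly bounded family of operators which preserves measurability of curves. -/
structure IsOpFamily (μ : Measure α) (B : α → H →L[ℝ] H) (C : ℝ) : Prop where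
  meas : ∀ F : α → H, AEStronglyMeasurable F μ → AEStronglyMeasurable (fun t => B t (F t)) μ
  bdd : ∀ t x, ‖B t x‖ ≤ C * ‖x‖

namespace IsOpFamily

variable {B : α → H →L[ℝ] H} {C : ℝ}

theorem memLp {p : ENNReal} (h : IsOpFamily μ B C) {F : α → H} (hF : MemLp F p μ) :
    MemLp (fun t => B t (F t)) p μ :=
  MemLp.of_le_mul hF (h.meas F hF.1) (Eventually.of_forall fun t => h.bdd t (F t))

/-- The operator on `L²(μ; H)` acting fibrewise. -/
noncomputable def lift (h : IsOpFamily μ B C) : Lp H 2 μ →L[ℝ] Lp H 2 μ :=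
  LinearMap.mkContinuous
    { toFun := fun F => (h.memLp (Lp.memLp F)).toLp
      map_add' := fun F F' => by
        refine Lp.ext ?_
        filter_upwards [(h.memLp (Lp.memLp (F + F'))).coeFn_toLp, (h.memLp (Lp.memLp F)).coeFn_toLp,
          (h.memLp (Lp.memLp F')).coeFn_toLp, Lp.coeFn_add F F',
          Lp.coeFn_add (h.memLp (Lp.memLp F)).toLp (h.memLp (Lp.memLp F')).toLp]
          with t h1 h2 h3 h4 h5
        rw [h1, h5, Pi.add_apply, h2, h3, h4, Pi.add_apply, map_add]
      map_smul' := fun c F => by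
        refine Lp.ext ?_
        filter_upwards [(h.memLp (Lp.memLp (c • F))).coeFn_toLp, (h.memLp (Lp.memLp F)).coeFn_toLp,
          Lp.coeFn_smul c F, Lp.coeFn_smul c (h.memLp (Lp.memLp F)).toLp] with t h1 h2 h3 h4
        rw [h1, RingHom.id_apply, h4, Pi.smul_apply, h2, h3, Pi.smul_apply, map_smul] }
    C fun F => by
      refine Lp.norm_le_mul_norm_of_ae_le_mul ?_
      filter_upwards [(h.memLp (Lp.memLp F)).coeFn_toLp] with t ht
      exact (congrArg norm ht).trans_le (h.bdd t _)

theorem coeFn_lift (h : IsOpFamily μ B C) (F : Lp H 2 μ) :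
    h.lift F =ᵐ[μ] fun t => B t (F t) :=
  (h.memLp (Lp.memLp F)).coeFn_toLp

theorem norm_lift_le (h : IsOpFamily μ B C) (F : Lp H 2 μ) : ‖h.lift F‖ ≤ C * ‖F‖ := by
  refine Lp.norm_le_mul_norm_of_ae_le_mul ?_
  filter_upwards [h.coeFn_lift F] with t ht
  rw [ht]
  exact h.bdd t _

theorem inner_lift_left (h : IsOpFamily μ B C) (hs : ∀ t x y, inner ℝ (B t x) y = inner ℝ x (B t y))
    (F G : Lp H 2 μ) : inner ℝ (h.lift F) G = inner ℝ F (h.lift G) := by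
  rw [L2.inner_def, L2.inner_def]
  refine integral_congr_ae ?_
  filter_upwards [h.coeFn_lift F, h.coeFn_lift G] with t h1 h2
  rw [h1, h2, hs]

theorem norm_commutator_le (h : IsOpFamily μ B C) (T : H →L[ℝ] H) {L : ℝ}
    (hL : ∀ t x, ‖T (B t x) - B t (T x)‖ ≤ L * ‖x‖) (F : Lp H 2 μ) :
    ‖T.compLpL 2 μ (h.lift F) - h.lift (T.compLpL 2 μ F)‖ ≤ L * ‖F‖ := by
  refine Lp.norm_le_mul_norm_of_ae_le_mul ?_
  filter_upwards [Lp.coeFn_sub (T.compLpL 2 μ (h.lift F)) (h.lift (T.compLpL 2 μ F)),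
    T.coeFn_compLpL (h.lift F), h.coeFn_lift F, h.coeFn_lift (T.compLpL 2 μ F),
    T.coeFn_compLpL F] with t h1 h2 h3 h4 h5
  rw [h1, Pi.sub_apply, h2, h3, h4, h5]
  exact hL t _

end IsOpFamily

theorem inner_compLpL_left_of_skew {T : H →L[ℝ] H} (hT : ∀ x y, inner ℝ (T x) y = -inner ℝ x (T y))
    (F G : Lp H 2 μ) : inner ℝ (T.compLpL 2 μ F) G = -inner ℝ F (T.compLpL 2 μ G) := by
  rw [L2.inner_def, L2.inner_def, ← integral_neg]
  refine integral_congr_ae ?_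
  filter_upwards [T.coeFn_compLpL F, T.coeFn_compLpL G] with t h1 h2
  rw [h1, h2, hT]

theorem compLpL_comm {T S : H →L[ℝ] H} (hT : ∀ x, T (S x) = S (T x)) (F : Lp H 2 μ) :
    T.compLpL 2 μ (S.compLpL 2 μ F) = S.compLpL 2 μ (T.compLpL 2 μ F) := by
  refine Lp.ext ?_
  filter_upwards [T.coeFn_compLpL (S.compLpL 2 μ F), S.coeFn_compLpL (T.compLpL 2 μ F),
    T.coeFn_compLpL F, S.coeFn_compLpL F] with t h1 h2 h3 h4
  rw [h1, h2, h3, h4, hT]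

theorem compLpL_indicatorConstLp (T : H →L[ℝ] H) {s : Set α} (hs : MeasurableSet s) (hμ : μ s ≠ ⊤)
    (c : H) : T.compLpL 2 μ (indicatorConstLp 2 hs hμ c) = indicatorConstLp 2 hs hμ (T c) := by
  refine Lp.ext ?_
  filter_upwards [T.coeFn_compLpL (indicatorConstLp 2 hs hμ c), indicatorConstLp_coeFn (p := 2)
    (hs := hs) (hμs := hμ) (c := c), indicatorConstLp_coeFn (p := 2)
    (hs := hs) (hμs := hμ) (c := T c)] with t h1 h2 h3
  rw [h1, h2, h3]
  by_cases ht : t ∈ s <;> simp [ht]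

omit [InnerProductSpace ℝ H] in
theorem tendsto_indicatorConstLp {ι : Type*} {l : Filter ι} {s : Set α} (hs : MeasurableSet s)
    (hμ : μ s ≠ ⊤) {c : ι → H} {z : H} (hc : Tendsto c l (𝓝 z)) :
    Tendsto (fun k => indicatorConstLp 2 hs hμ (c k)) l (𝓝 (indicatorConstLp 2 hs hμ z)) := by
  rw [tendsto_iff_norm_sub_tendsto_zero] at hc ⊢
  have h := hc.mul_const (μ.real s ^ (1 / (2 : ENNReal).toReal))
  rw [zero_mul] at h
  exact squeeze_zero (fun _ => norm_nonneg _) (fun k => by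
    rw [indicatorConstLp_sub]; exact norm_indicatorConstLp_le) h

end Lift

/-! ### Integration in time as an accretive operator -/

section Volterra

variable {H : Type*} [NormedAddCommGroup H] [InnerProductSpace ℝ H] [CompleteSpace H] {a b : ℝ}

omit [InnerProductSpace ℝ H] [CompleteSpace H] in
theorem Lp.integrableOn_Icc (F : Lp H 2 (volume.restrict (Icc a b))) : IntegrableOn F (Icc a b) :=
  (Lp.memLp F).integrable (by norm_num)

omit [InnerProductSpace ℝ H] [CompleteSpace H] in
theorem Lp.intervalIntegrable (F : Lp H 2 (volume.restrict (Icc a b))) {s t : ℝ}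
    (hs : s ∈ Icc a b) (ht : t ∈ Icc a b) : IntervalIntegrable F volume s t :=
  ((Lp.integrableOn_Icc F).mono_set (uIcc_subset_Icc hs ht)).intervalIntegrable

omit [CompleteSpace H] in
theorem Lp.isPrimitive (F : Lp H 2 (volume.restrict (Icc a b))) {c : ℝ} (hc : c ∈ Icc a b) :
    IsPrimitive a b (fun t => ∫ τ in c..t, F τ) F where
  integrableOn := Lp.integrableOn_Icc F
  eq_add _ ht := (intervalIntegral.integral_add_adjacent_intervals
    (Lp.intervalIntegrable F hc ⟨le_rfl, ht.1.trans ht.2⟩)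
    (Lp.intervalIntegrable F ⟨le_rfl, ht.1.trans ht.2⟩ ht)).symm

theorem IsPrimitive.memLp {E : Type*} [NormedAddCommGroup E] [NormedSpace ℝ E] [CompleteSpace E]
    {u g : ℝ → E} (h : IsPrimitive a b u g) (p : ENNReal) :
    MemLp u p (volume.restrict (Icc a b)) := by
  obtain ⟨C, -, hC⟩ := h.exists_bound
  exact MemLp.of_bound h.aestronglyMeasurable C
    ((ae_restrict_iff' measurableSet_Icc).2 (Eventually.of_forall hC))

omit [InnerProductSpace ℝ H] [CompleteSpace H] in
theorem Lp.exists_integral_norm_le (a b : ℝ) : ∃ C, 0 ≤ C ∧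
    ∀ F : Lp H 2 (volume.restrict (Icc a b)), ∫ t in Icc a b, ‖F t‖ ≤ C * ‖F‖ := by
  set μ := volume.restrict (Icc a b)
  refine ⟨(μ univ ^ (1 / (1 : ENNReal).toReal - 1 / (2 : ENNReal).toReal)).toReal,
    ENNReal.toReal_nonneg, fun F => ?_⟩
  have h := eLpNorm_le_eLpNorm_mul_rpow_measure_univ (p := 1) (q := 2) (by norm_num)
    (Lp.aestronglyMeasurable F)
  have h1 : ∫ t in Icc a b, ‖F t‖ = (eLpNorm F 1 μ).toReal := by
    rw [integral_norm_eq_lintegral_enorm (Lp.aestronglyMeasurable F), eLpNorm_one_eq_lintegral_enorm]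
  rw [h1, Lp.norm_def, mul_comm, ← ENNReal.toReal_mul]
  refine ENNReal.toReal_mono (ENNReal.mul_ne_top (Lp.eLpNorm_ne_top F) ?_) h
  refine ENNReal.rpow_ne_top_of_nonneg ?_ (measure_ne_top _ _)
  norm_num

/-- The integration operator `F ↦ ∫_c^t F` on `L²([a,b]; H)`. -/
noncomputable def volterra {c : ℝ} (hc : c ∈ Icc a b) :
    Lp H 2 (volume.restrict (Icc a b)) →L[ℝ] Lp H 2 (volume.restrict (Icc a b)) :=
  LinearMap.mkContinuousOfExistsBound
    { toFun := fun F => ((Lp.isPrimitive F hc).memLp 2).toLp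
      map_add' := fun F G => by
        rw [← MemLp.toLp_add]
        refine MemLp.toLp_congr _ _ ?_
        refine (ae_restrict_iff' measurableSet_Icc).2 (Eventually.of_forall fun t ht => ?_)
        rw [Pi.add_apply, ← intervalIntegral.integral_add (Lp.intervalIntegrable F hc ht)
          (Lp.intervalIntegrable G hc ht)]
        refine intervalIntegral.integral_congr_ae_restrict ?_
        exact ae_restrict_of_ae_restrict_of_subset
          (uIoc_subset_uIcc.trans (uIcc_subset_Icc hc ht)) (Lp.coeFn_add F G)
      map_smul' := fun r F => by
        rw [RingHom.id_apply, ← MemLp.toLp_const_smul]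
        refine MemLp.toLp_congr _ _ ?_
        refine (ae_restrict_iff' measurableSet_Icc).2 (Eventually.of_forall fun t ht => ?_)
        rw [Pi.smul_apply, ← intervalIntegral.integral_smul]
        refine intervalIntegral.integral_congr_ae_restrict ?_
        exact ae_restrict_of_ae_restrict_of_subset
          (uIoc_subset_uIcc.trans (uIcc_subset_Icc hc ht)) (Lp.coeFn_smul r F) } (by
    obtain ⟨C, hC0, hC⟩ := Lp.exists_integral_norm_le (H := H) a b
    set μ := volume.restrict (Icc a b)
    refine ⟨μ.real univ ^ ((2 : ENNReal).toReal)⁻¹ * C, fun F => ?_⟩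
    refine (Lp.norm_le_of_ae_bound (C := C * ‖F‖) (by positivity) ?_).trans_eq (by
      rw [mul_assoc]; rfl)
    filter_upwards [((Lp.isPrimitive F hc).memLp 2).coeFn_toLp,
      ae_restrict_mem (μ := volume) measurableSet_Icc] with t h1 ht
    refine (congrArg norm h1).trans_le ?_
    refine (intervalIntegral.norm_integral_le_integral_norm_uIoc).trans (le_trans ?_ (hC F))
    exact setIntegral_mono_set (Lp.integrableOn_Icc F).norm
      (Eventually.of_forall fun _ => norm_nonneg _)
      (uIoc_subset_uIcc.trans (uIcc_subset_Icc hc ht)).eventuallyLE)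

theorem coeFn_volterra {c : ℝ} (hc : c ∈ Icc a b) (F : Lp H 2 (volume.restrict (Icc a b))) :
    volterra hc F =ᵐ[volume.restrict (Icc a b)] fun t => ∫ τ in c..t, F τ :=
  ((Lp.isPrimitive F hc).memLp 2).coeFn_toLp

theorem compLpL_volterra {c : ℝ} (hc : c ∈ Icc a b) (T : H →L[ℝ] H)
    (F : Lp H 2 (volume.restrict (Icc a b))) :
    T.compLpL 2 _ (volterra hc F) = volterra hc (T.compLpL 2 _ F) := by
  refine Lp.ext ?_
  filter_upwards [T.coeFn_compLpL (volterra hc F), coeFn_volterra hc F,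
    coeFn_volterra hc (T.compLpL 2 _ F), ae_restrict_mem measurableSet_Icc] with t h1 h2 h3 ht
  rw [h1, h2, h3, ← T.intervalIntegral_comp_comm (Lp.intervalIntegrable F hc ht)]
  refine intervalIntegral.integral_congr_ae_restrict ?_
  exact ae_restrict_of_ae_restrict_of_subset
    (uIoc_subset_uIcc.trans (uIcc_subset_Icc hc ht)) (T.coeFn_compLpL F).symm

/-- This is the product rule for `‖∫_c^t F‖²`. For `c = a` only a nonnegative endpoint term
survives, for `c = b` only a nonpositive one; hence forward integration, and minus backward
integration, are accretive. -/
theorem two_mul_inner_volterra {c : ℝ} (hc : c ∈ Icc a b)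
    (F : Lp H 2 (volume.restrict (Icc a b))) :
    2 * inner ℝ (volterra hc F) F = ‖∫ τ in c..b, F τ‖ ^ 2 - ‖∫ τ in c..a, F τ‖ ^ 2 := by
  have hab : a ≤ b := hc.1.trans hc.2
  have hP := Lp.isPrimitive F hc
  have h := (hP.bilin (innerSL ℝ) hP).sub_eq ⟨le_rfl, hab⟩ ⟨hab, le_rfl⟩
  rw [← real_inner_self_eq_norm_sq, ← real_inner_self_eq_norm_sq]
  refine Eq.trans ?_ h.symm
  rw [L2.inner_def, ← integral_const_mul, intervalIntegral.integral_of_le hab,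
    ← integral_Icc_eq_integral_Ioc]
  refine integral_congr_ae ?_
  filter_upwards [coeFn_volterra hc F] with t ht
  rw [ht, two_mul]
  exact congrArg₂ _ rfl (real_inner_comm _ _)

theorem inner_volterra_left_nonneg (hab : a ≤ b) (F : Lp H 2 (volume.restrict (Icc a b))) :
    0 ≤ inner ℝ (volterra (left_mem_Icc.2 hab) F) F := by
  have h := two_mul_inner_volterra (left_mem_Icc.2 hab) F
  rw [intervalIntegral.integral_same, norm_zero] at h
  nlinarith [sq_nonneg ‖∫ τ in a..b, F τ‖]

theorem inner_volterra_right_nonpos (hab : a ≤ b) (F : Lp H 2 (volume.restrict (Icc a b))) :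
    inner ℝ (volterra (right_mem_Icc.2 hab) F) F ≤ 0 := by
  have h := two_mul_inner_volterra (right_mem_Icc.2 hab) F
  rw [intervalIntegral.integral_same, norm_zero] at h
  nlinarith [sq_nonneg ‖∫ τ in b..a, F τ‖]

end Volterra

/-! ### Solvability of first-order evolution equations -/

section Evolution

variable {n : ℕ} {a b K L : ℝ}

/-- Coefficients on `[a,b] × ℝⁿ`: jointly measurable, bounded by `K`, and `L`-Lipschitz along the
coordinate directions of `ℝⁿ`. -/
structure IsCoefficient (a b K L : ℝ) (β : ℝ → StateSpace n → ℝ) : Prop where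
  meas : AEStronglyMeasurable (fun z : StateSpace n × ℝ => β z.2 z.1)
    (volume.prod (volume.restrict (Icc a b)))
  slice : ∀ t, AEStronglyMeasurable (β t) volume
  bdd : ∀ t x, |β t x| ≤ K
  lip : ∀ i t x (s : ℝ), |β t (x + s • stdVec i) - β t x| ≤ L * |s|

namespace IsCoefficient

variable {β : ℝ → StateSpace n → ℝ}

theorem memLp (h : IsCoefficient a b K L β) (t : ℝ) : MemLp (β t) ⊤ volume :=
  memLp_top_of_abs_le (h.slice t) (h.bdd t)

/-- Pairings with fixed elements are parameter integrals of jointly measurable functions, and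
separability upgrades weak measurability to strong. -/
theorem aestronglyMeasurable_mulOp_const (h : IsCoefficient a b K L β) (y : HZero n) :
    AEStronglyMeasurable (fun t => mulOp (β t) y) (volume.restrict (Icc a b)) := by
  refine aestronglyMeasurable_of_inner fun z => ?_
  have h1 : (fun t => inner ℝ z (mulOp (β t) y)) = fun t => ∫ x, z x * (β t x * y x) := by
    funext t
    rw [HZero.inner_eq]
    refine integral_congr_ae ?_
    filter_upwards [coeFn_mulOp (h.memLp t) y] with x hx
    rw [hx]
  rw [h1]
  have h2 : AEStronglyMeasurable (fun q : StateSpace n × ℝ => z q.1 * (β q.2 q.1 * y q.1))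
      (volume.prod (volume.restrict (Icc a b))) :=
    (Lp.aestronglyMeasurable z).comp_fst.mul (h.meas.mul (Lp.aestronglyMeasurable y).comp_fst)
  exact h2.prod_swap.integral_prod_right'

/-- For a moving argument `F t`, self-adjointness transfers the multiplier to the fixed test
element, where measurability is known. -/
theorem isOpFamily (h : IsCoefficient a b K L β) :
    IsOpFamily (volume.restrict (Icc a b)) (fun t => mulOp (β t)) K where
  meas F hF := by
    refine aestronglyMeasurable_of_inner fun z => ?_
    simp_rw [← inner_mulOp_left]
    exact (h.aestronglyMeasurable_mulOp_const z).inner hF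
  bdd t x := norm_mulOp_le (h.bdd t) x

end IsCoefficient

/-- Existence for the evolution equation `u = V G`, `G = ∑ βᵢ ∂ᵢu + γ u - λ u + φ` with an accretive
operator `V` in the time variable. -/
theorem exists_weak_evolution {β : Fin n → ℝ → StateSpace n → ℝ} {γ : ℝ → StateSpace n → ℝ}
    (hβ : ∀ i, IsCoefficient a b K L (β i)) (hγ : IsCoefficient a b K L γ) (hL : 0 ≤ L)
    (V : Lp (HZero n) 2 (volume.restrict (Icc a b)) →L[ℝ] Lp (HZero n) 2 (volume.restrict (Icc a b)))
    (hV : ∀ F, 0 ≤ inner ℝ (V F) F)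
    (hVT : ∀ (T : HZero n →L[ℝ] HZero n) F, T.compLpL 2 _ (V F) = V (T.compLpL 2 _ F))
    (φ : Lp (HZero n) 2 (volume.restrict (Icc a b))) {R : ℝ}
    (hR : ∀ k j, ‖(diffQuot j (step k)).compLpL 2 _ φ‖ ≤ R) :
    ∃ (G : Lp (HZero n) 2 (volume.restrict (Icc a b)))
      (w : Fin n → Lp (HZero n) 2 (volume.restrict (Icc a b))),
      ∀ᵐ t ∂(volume.restrict (Icc a b)), (∀ i, HasWeakPartial i (V G t) (w i t)) ∧
        G t = ∑ i, mulOp (β i t) (w i t) + mulOp (γ t) (V G t) - (2 * n * L + K + 1) • V G t + φ t := by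
  let μ : Measure ℝ := volume.restrict (Icc a b)
  have htd : ∀ k, TransportData V (fun i => (hβ i).isOpFamily.lift) hγ.isOpFamily.lift L K
      (fun i => (diffQuot i (step k)).compLpL 2 μ) := fun k =>
    { skew := fun i => inner_compLpL_left_of_skew (inner_diffQuot_left i (step k))
      comm_V := fun i => hVT _
      comm_D := fun i j => compLpL_comm (diffQuot_comm i j (step k))
      symm_M := fun i => (hβ i).isOpFamily.inner_lift_left fun t => inner_mulOp_left (β i t)
      norm_N := hγ.isOpFamily.norm_lift_le
      comm_M := fun i j => (hβ i).isOpFamily.norm_commutator_le _ fun t =>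
        norm_diffQuot_mulOp_sub_le ((hβ i).slice t) ((hβ i).bdd t) ((hβ i).lip j t) (step_pos k).ne'
      comm_N := fun j => hγ.isOpFamily.norm_commutator_le _ fun t =>
        norm_diffQuot_mulOp_sub_le (hγ.slice t) (hγ.bdd t) (hγ.lip j t) (step_pos k).ne' }
  obtain ⟨G, w, hG, hw⟩ := exists_limit_solution htd hL hV
    (lam := 2 * n * L + K + 1) (by rw [Fintype.card_fin]) φ hR
  refine ⟨G, w, ?_⟩
  have hweak : ∀ i, ∀ᵐ t ∂μ, HasWeakPartial i (V G t) (w i t) := by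
    intro i
    obtain ⟨Q, hQc, hQ, hQw⟩ := exists_countable_test (n := n) i
    have : ∀ᵐ t ∂μ, ∀ q ∈ Q, inner ℝ (V G t) q.2 = -inner ℝ (w i t) q.1 := by
      rw [ae_ball_iff hQc]
      intro q hq
      obtain ⟨ψ, hψ, rfl⟩ := hQ q hq
      have hint : Integrable (fun t => inner ℝ (hψ.pderiv i).toH (V G t) + inner ℝ hψ.toH (w i t))
          μ :=
        (((Lp.memLp (V G)).integrable (by norm_num)).const_inner _).add
          (((Lp.memLp (w i)).integrable (by norm_num)).const_inner _)
      -- The abstract limit identity is applied to `1_S(t) ψ(x)`, whose difference quotients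
      -- converge strongly. It gives the weak derivative identity integrated over every measurable
      -- set `S` of times, hence at almost every time.
      have h0 := ae_eq_zero_of_forall_setIntegral_eq_of_sigmaFinite
        (fun s _ _ => hint.integrableOn) (fun s hs hμs => by
          have h1 := hw i (indicatorConstLp 2 hs hμs.ne hψ.toH)
            (indicatorConstLp 2 hs hμs.ne (hψ.pderiv i).toH) (by
              simp_rw [compLpL_indicatorConstLp]
              exact tendsto_indicatorConstLp hs hμs.ne (hψ.tendsto_diffQuot i))
          rw [real_inner_comm, real_inner_comm (indicatorConstLp _ _ _ _) (V G),
            L2.inner_indicatorConstLp_eq_setIntegral_inner,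
            L2.inner_indicatorConstLp_eq_setIntegral_inner] at h1
          rw [integral_add, h1, add_neg_cancel]
          · exact (((Lp.memLp (V G)).integrable (by norm_num)).const_inner _).integrableOn
          · exact (((Lp.memLp (w i)).integrable (by norm_num)).const_inner _).integrableOn)
      filter_upwards [h0] with t ht
      rw [real_inner_comm, real_inner_comm hψ.toH]
      exact eq_neg_of_add_eq_zero_left ht
    filter_upwards [this] with t ht using hQw _ _ ht
  have hsum : ∀ F : Fin n → Lp (HZero n) 2 μ, ∀ᵐ t ∂μ, (∑ i, F i : Lp (HZero n) 2 μ) t = ∑ i, F i t := by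
    intro F
    have := Lp.coeFn_finsetSum Finset.univ F
    filter_upwards [this] with t ht
    rw [ht, Finset.sum_apply]
  have hae : G =ᵐ[μ] (∑ i, (hβ i).isOpFamily.lift (w i) + hγ.isOpFamily.lift (V G) -
      (2 * n * L + K + 1) • V G + φ : Lp (HZero n) 2 μ) := by rw [← hG]
  filter_upwards [ae_all_iff.2 hweak, hae,
    Lp.coeFn_add (∑ i, (hβ i).isOpFamily.lift (w i) + hγ.isOpFamily.lift (V G) -
      (2 * n * L + K + 1) • V G) φ,
    Lp.coeFn_sub (∑ i, (hβ i).isOpFamily.lift (w i) + hγ.isOpFamily.lift (V G))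
      ((2 * n * L + K + 1) • V G),
    Lp.coeFn_add (∑ i, (hβ i).isOpFamily.lift (w i)) (hγ.isOpFamily.lift (V G)),
    Lp.coeFn_smul (2 * n * L + K + 1) (V G), hγ.isOpFamily.coeFn_lift (V G),
    ae_all_iff.2 fun i => (hβ i).isOpFamily.coeFn_lift (w i), hsum fun i => (hβ i).isOpFamily.lift (w i)]
    with t h1 h2 h3 h4 h5 h6 h7 h8 h9
  refine ⟨h1, ?_⟩
  rw [h2, h3, Pi.add_apply, h4, Pi.sub_apply, h5, Pi.add_apply, h6, Pi.smul_apply, h7, h9]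
  simp_rw [h8]

theorem exists_exp_le (a b c : ℝ) : ∃ M, 0 ≤ M ∧ ∀ t ∈ Icc a b, Real.exp (c * t) ≤ M := by
  obtain ⟨M, hM⟩ := (isCompact_Icc (a := a) (b := b)).exists_bound_of_continuousOn
    (f := fun t => Real.exp (c * t)) (by fun_prop)
  refine ⟨|M|, abs_nonneg M, fun t ht => ?_⟩
  have := hM t ht
  rw [Real.norm_eq_abs, Real.abs_exp] at this
  exact this.trans (le_abs_self M)

theorem MemLp.exp_smul {H : Type*} [NormedAddCommGroup H] [NormedSpace ℝ H] {p : ENNReal}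
    {F : ℝ → H} (hF : MemLp F p (volume.restrict (Icc a b))) (c : ℝ) :
    MemLp (fun t => Real.exp (c * t) • F t) p (volume.restrict (Icc a b)) := by
  obtain ⟨M, -, hM⟩ := exists_exp_le a b c
  refine MemLp.of_le_mul (c := M) hF
    ((by fun_prop : Continuous fun t => Real.exp (c * t)).aestronglyMeasurable.smul hF.1) ?_
  filter_upwards [ae_restrict_mem measurableSet_Icc] with t ht
  rw [norm_smul, Real.norm_eq_abs, Real.abs_exp]
  gcongr
  exact hM t ht

/-- Multiplication of a primitive by an exponential. -/
theorem IsPrimitive.exp_smul {H : Type*} [NormedAddCommGroup H] [NormedSpace ℝ H] [CompleteSpace H]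
    {u g : ℝ → H} (h : IsPrimitive a b u g) (c : ℝ) :
    IsPrimitive a b (fun t => Real.exp (c * t) • u t)
      (fun t => Real.exp (c * t) • (g t + c • u t)) := by
  have hexp : IsPrimitive a b (fun t => Real.exp (c * t)) (fun t => c * Real.exp (c * t)) := by
    refine ⟨(by fun_prop : Continuous fun t => c * Real.exp (c * t)).integrableOn_Icc,
      fun t _ => ?_⟩
    rw [intervalIntegral.integral_eq_sub_of_hasDerivAt (f := fun t => Real.exp (c * t))]
    · ring
    · intro s _
      have := ((hasDerivAt_id s).const_mul c).exp
      simpa [mul_comm] using this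
    · exact (by fun_prop : Continuous fun t => c * Real.exp (c * t)).intervalIntegrable _ _
  have h1 := hexp.bilin (ContinuousLinearMap.lsmul ℝ ℝ) h
  refine ⟨h1.integrableOn.congr (Eventually.of_forall fun t => ?_), fun t ht => ?_⟩
  · simp [smul_add, smul_smul, mul_comm]
  · have := h1.eq_add t ht
    simp only [ContinuousLinearMap.lsmul_apply] at this
    rw [this]
    congr 1
    refine intervalIntegral.integral_congr fun t _ => ?_
    simp [smul_add, smul_smul, mul_comm]

/-- Existence for `u' = σ (∑ βᵢ ∂ᵢu + γ u + φ)`, `u(c) = 0`, where `σ = 1`, `c = a` or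
`σ = -1`, `c = b`. -/
theorem exists_evolution_aux {β : Fin n → ℝ → StateSpace n → ℝ} {γ : ℝ → StateSpace n → ℝ}
    (hβ : ∀ i, IsCoefficient a b K L (β i)) (hγ : IsCoefficient a b K L γ) (hL : 0 ≤ L)
    {c : ℝ} (hc : c ∈ Icc a b) {σ : ℝ}
    (hV : ∀ F : Lp (HZero n) 2 (volume.restrict (Icc a b)), 0 ≤ σ * inner ℝ (volterra hc F) F)
    {φ : ℝ → HZero n} (hφ : MemLp φ 2 (volume.restrict (Icc a b))) {r : ℝ → ℝ}
    (hr : MemLp r 2 (volume.restrict (Icc a b)))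
    (hφr : ∀ᵐ t ∂(volume.restrict (Icc a b)), ∀ k j, ‖diffQuot j (step k) (φ t)‖ ≤ r t) :
    ∃ (u g : ℝ → HZero n) (w : Fin n → ℝ → HZero n), IsPrimitive a b u g ∧ u c = 0 ∧
      (∀ i, MemLp (w i) 2 (volume.restrict (Icc a b))) ∧
      ∀ᵐ t ∂(volume.restrict (Icc a b)), (∀ i, HasWeakPartial i (u t) (w i t)) ∧
        g t = σ • (∑ i, mulOp (β i t) (w i t) + mulOp (γ t) (u t) + φ t) := by
  set μ := volume.restrict (Icc a b)
  -- Substituting `u = exp (σ lam t) v` produces the term `-lam v` that makes the spatial operator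
  -- strictly dissipative; the source is weighted by the inverse exponential.
  set lam := 2 * n * L + K + 1
  have hφ' := MemLp.exp_smul hφ (-(σ * lam))
  have hr' := MemLp.exp_smul hr (-(σ * lam))
  obtain ⟨G, w, hGw⟩ := exists_weak_evolution hβ hγ hL (σ • volterra hc)
    (fun F => by
      rw [_root_.smul_apply, real_inner_smul_left]; exact hV F)
    (fun T F => by
      rw [_root_.smul_apply, _root_.smul_apply, map_smul, compLpL_volterra])
    (hφ'.toLp _) (R := ‖hr'.toLp _‖) (fun k j => by
      refine Lp.norm_le_norm_of_ae_le ?_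
      filter_upwards [(diffQuot j (step k)).coeFn_compLpL (hφ'.toLp _), hφ'.coeFn_toLp,
        hr'.coeFn_toLp, hφr] with t h1 h2 h3 h4
      rw [h1, h2, h3, map_smul, norm_smul, norm_smul]
      gcongr
      exact (h4 k j).trans (le_abs_self _))
  let v : ℝ → HZero n := fun t => σ • ∫ τ in c..t, G τ
  have hv : IsPrimitive a b v (fun t => σ • G t) := by
    have h := Lp.isPrimitive G hc
    refine ⟨h.integrableOn.smul σ, fun t ht => ?_⟩
    simp only [v]
    rw [h.eq_add t ht, smul_add, intervalIntegral.integral_smul]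
  refine ⟨_, _, fun i t => Real.exp (σ * lam * t) • w i t, hv.exp_smul (σ * lam), ?_,
    fun i => MemLp.exp_smul (Lp.memLp (w i)) _, ?_⟩
  · simp [v]
  · filter_upwards [hGw, Lp.coeFn_smul σ (volterra hc G), coeFn_volterra hc G, hφ'.coeFn_toLp]
      with t h1 h2 h3 h4
    have hVG : (σ • volterra hc) G t = v t := by
      rw [_root_.smul_apply, h2, Pi.smul_apply, h3]
    rw [hVG] at h1
    refine ⟨fun i => (h1.1 i).smul _, ?_⟩
    have hE : Real.exp (σ * lam * t) * Real.exp (-(σ * lam) * t) = 1 := by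
      rw [← Real.exp_add, ← Real.exp_zero]; congr 1; ring
    have h5 : φ t = Real.exp (σ * lam * t) • (hφ'.toLp _ : Lp (HZero n) 2 μ) t := by
      rw [h4, smul_smul, hE, one_smul]
    rw [h5, h1.2]
    simp only [map_smul, ← Finset.smul_sum, ← smul_add]
    rw [smul_comm σ, mul_smul, ← smul_add]
    congr 2
    abel

theorem exists_forward_evolution {β : Fin n → ℝ → StateSpace n → ℝ} {γ : ℝ → StateSpace n → ℝ}
    (hab : a ≤ b)
    (hβ : ∀ i, IsCoefficient a b K L (β i)) (hγ : IsCoefficient a b K L γ) (hL : 0 ≤ L)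
    {φ : ℝ → HZero n} (hφ : MemLp φ 2 (volume.restrict (Icc a b))) {r : ℝ → ℝ}
    (hr : MemLp r 2 (volume.restrict (Icc a b)))
    (hφr : ∀ᵐ t ∂(volume.restrict (Icc a b)), ∀ k j, ‖diffQuot j (step k) (φ t)‖ ≤ r t) :
    ∃ (u g : ℝ → HZero n) (w : Fin n → ℝ → HZero n), IsPrimitive a b u g ∧ u a = 0 ∧
      (∀ i, MemLp (w i) 2 (volume.restrict (Icc a b))) ∧
      ∀ᵐ t ∂(volume.restrict (Icc a b)), (∀ i, HasWeakPartial i (u t) (w i t)) ∧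
        g t = ∑ i, mulOp (β i t) (w i t) + mulOp (γ t) (u t) + φ t := by
  simpa only [one_smul] using exists_evolution_aux hβ hγ hL (left_mem_Icc.2 hab) (σ := 1)
    (fun F => by rw [one_mul]; exact inner_volterra_left_nonneg hab F) hφ hr hφr

theorem exists_backward_evolution {β : Fin n → ℝ → StateSpace n → ℝ} {γ : ℝ → StateSpace n → ℝ}
    (hab : a ≤ b)
    (hβ : ∀ i, IsCoefficient a b K L (β i)) (hγ : IsCoefficient a b K L γ) (hL : 0 ≤ L)
    {φ : ℝ → HZero n} (hφ : MemLp φ 2 (volume.restrict (Icc a b))) {r : ℝ → ℝ}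
    (hr : MemLp r 2 (volume.restrict (Icc a b)))
    (hφr : ∀ᵐ t ∂(volume.restrict (Icc a b)), ∀ k j, ‖diffQuot j (step k) (φ t)‖ ≤ r t) :
    ∃ (u g : ℝ → HZero n) (w : Fin n → ℝ → HZero n), IsPrimitive a b u g ∧ u b = 0 ∧
      (∀ i, MemLp (w i) 2 (volume.restrict (Icc a b))) ∧
      ∀ᵐ t ∂(volume.restrict (Icc a b)), (∀ i, HasWeakPartial i (u t) (w i t)) ∧
        g t = -(∑ i, mulOp (β i t) (w i t) + mulOp (γ t) (u t) + φ t) := by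
  simpa only [neg_smul, one_smul] using exists_evolution_aux hβ hγ hL (right_mem_Icc.2 hab)
    (σ := -1)
    (fun F => by have := inner_volterra_right_nonpos hab F; linarith) hφ hr hφr

end Evolution

/-! ### Coefficients extracted from the vector field -/

section Coefficients

variable {n : ℕ} {a b K L : ℝ}

theorem abs_sub_le_of_lineDeriv {g : StateSpace n → ℝ} {e : StateSpace n} {K : ℝ}
    (hd : ∀ x, LineDifferentiableAt ℝ g x e) (hb : ∀ x, |lineDeriv ℝ g x e| ≤ K)
    (x : StateSpace n) (s : ℝ) : |g (x + s • e) - g x| ≤ K * |s| := by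
  have hder : ∀ r : ℝ, HasDerivAt (fun r : ℝ => g (x + r • e)) (lineDeriv ℝ g (x + r • e) e) r := by
    intro r
    have h1 : HasDerivAt (fun t : ℝ => g (x + r • e + t • e)) (lineDeriv ℝ g (x + r • e) e)
        (r - r) := by
      rw [sub_self]; exact (hd (x + r • e)).hasLineDerivAt
    have h2 := h1.comp_sub_const r r
    refine h2.congr_of_eventuallyEq (Eventually.of_forall fun t => ?_)
    simp only [add_assoc, ← add_smul, add_sub_cancel]
  have h := (convex_univ (𝕜 := ℝ) (E := ℝ)).norm_image_sub_le_of_norm_hasDerivWithin_le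
    (fun r _ => (hder r).hasDerivWithinAt) (fun r _ => hb (x + r • e)) (mem_univ 0) (mem_univ s)
  simpa using h

namespace IsCoefficient

variable {β : ℝ → StateSpace n → ℝ}

theorem mono (h : IsCoefficient a b K L β) {a' b' K' L' : ℝ} (hI : Icc a' b' ⊆ Icc a b)
    (hK : K ≤ K') (hL : L ≤ L') : IsCoefficient a' b' K' L' β where
  meas := h.meas.mono_ac (Measure.AbsolutelyContinuous.rfl.prod
    (Measure.restrict_mono hI le_rfl).absolutelyContinuous)
  slice := h.slice
  bdd t x := (h.bdd t x).trans hK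
  lip i t x s := (h.lip i t x s).trans (by gcongr)

theorem neg (h : IsCoefficient a b K L β) : IsCoefficient a b K L (fun t x => -β t x) where
  meas := h.meas.neg
  slice t := (h.slice t).neg
  bdd t x := by rw [abs_neg]; exact h.bdd t x
  lip i t x s := by
    rw [neg_sub_neg, abs_sub_comm]; exact h.lip i t x s

theorem zero (hK : 0 ≤ K) (hL : 0 ≤ L) :
    IsCoefficient a b K L (fun _ (_ : StateSpace n) => (0 : ℝ)) where
  meas := aestronglyMeasurable_const
  slice _ := aestronglyMeasurable_const
  bdd _ _ := by simpa using hK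
  lip _ _ _ s := by simpa using mul_nonneg hL (abs_nonneg s)

theorem sum {ι : Type*} [Fintype ι] {β : ι → ℝ → StateSpace n → ℝ}
    (h : ∀ i, IsCoefficient a b K L (β i)) :
    IsCoefficient a b (Fintype.card ι * K) (Fintype.card ι * L) (fun t x => ∑ i, β i t x) where
  meas := Finset.aestronglyMeasurable_fun_sum _ fun i _ => (h i).meas
  slice t := Finset.aestronglyMeasurable_fun_sum _ fun i _ => (h i).slice t
  bdd t x := by
    refine (Finset.abs_sum_le_sum_abs _ _).trans ((Finset.sum_le_sum fun i _ =>
      (h i).bdd t x).trans_eq ?_)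
    rw [Finset.sum_const, Finset.card_univ, nsmul_eq_mul]
  lip j t x s := by
    rw [← Finset.sum_sub_distrib]
    refine (Finset.abs_sum_le_sum_abs _ _).trans ((Finset.sum_le_sum fun i _ =>
      (h i).lip j t x s).trans_eq ?_)
    rw [Finset.sum_const, Finset.card_univ, nsmul_eq_mul, mul_assoc]

end IsCoefficient

theorem mulOp_neg {c : StateSpace n → ℝ} (hc : MemLp c ⊤ volume) (u : HZero n) :
    mulOp (fun x => -c x) u = -mulOp c u := by
  refine Lp.ext ?_
  filter_upwards [coeFn_mulOp hc.neg u, Lp.coeFn_neg (mulOp c u), coeFn_mulOp hc u] with x h1 h2 h3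
  rw [h2, Pi.neg_apply, h3, ← neg_mul]
  exact h1

theorem HZero.coeFn_sum {ι : Type*} [Fintype ι] (u : ι → HZero n) :
    ∀ᵐ x, (∑ i, u i : HZero n) x = ∑ i, u i x := by
  filter_upwards [Lp.coeFn_finsetSum Finset.univ u] with x hx
  rw [hx, Finset.sum_apply]

theorem mulOp_sum {ι : Type*} [Fintype ι] {c : ι → StateSpace n → ℝ}
    (hc : ∀ i, MemLp (c i) ⊤ volume) (u : HZero n) :
    mulOp (fun x => ∑ i, c i x) u = ∑ i, mulOp (c i) u := by
  refine Lp.ext ?_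
  filter_upwards [coeFn_mulOp (memLp_finsetSum Finset.univ fun i _ => hc i) u,
    HZero.coeFn_sum fun i => mulOp (c i) u, ae_all_iff.2 fun i => coeFn_mulOp (hc i) u]
    with x h1 h2 h3
  rw [h1, h2, Finset.sum_mul]
  simp_rw [h3]

/-- The components `β` of a regular field together with their derivatives `dβ i = ∂ᵢ βᵢ`, modified
on a null set of times. -/
structure IsFieldCoefficients (T C : ℝ) (f : StateSpace n → ℝ → StateSpace n)
    (β dβ : Fin n → ℝ → StateSpace n → ℝ) : Prop where
  nonneg : 0 ≤ C
  coeff : ∀ i, IsCoefficient 0 T C C (β i)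
  dcoeff : ∀ i, IsCoefficient 0 T C C (dβ i)
  hasLineDerivAt : ∀ i t x, HasLineDerivAt ℝ (β i t) (dβ i t x) x (stdVec i)
  ae_eq : ∀ᵐ t ∂(volume.restrict (Icc 0 T)), ∀ i x, β i t x = f x t i

theorem RegularField.exists_coefficients {T : ℝ} {f : StateSpace n → ℝ → StateSpace n}
    (hf : RegularField T f) : ∃ C β dβ, IsFieldCoefficients T C f β dβ := by
  classical
  obtain ⟨K, hK⟩ := hf.bounded
  set μ := volume.restrict (Icc 0 T)
  let g : Fin n → ℝ → StateSpace n → ℝ := fun i t x => f x t i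
  let dg : Fin n → ℝ → StateSpace n → ℝ := fun i t x => partialX i (fun y => f y t i) x
  -- Joint measurability gives measurable slices only for almost every `t`. Setting the coefficients
  -- to zero at all other times makes every slice condition hold without exception.
  let good : Set ℝ := {t | t ∈ Icc 0 T ∧ ∀ i, AEStronglyMeasurable (g i t) volume ∧
    AEStronglyMeasurable (dg i t) volume}
  have hslice : ∀ {q : ℝ → StateSpace n → ℝ},
      AEMeasurable (fun z : StateSpace n × ℝ => q z.2 z.1) (volume.prod μ) →
      ∀ᵐ t ∂μ, AEStronglyMeasurable (q t) volume := fun hq =>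
    hq.aestronglyMeasurable.prod_swap.prodMk_left
  have hgood : ∀ᵐ t ∂μ, t ∈ good := by
    filter_upwards [ae_restrict_mem (μ := volume) (measurableSet_Icc (a := (0 : ℝ)) (b := T)),
      ae_all_iff.2 fun i => hslice (q := g i) (hf.measurable_field i),
      ae_all_iff.2 fun i => hslice (q := dg i) (hf.measurable_first i i)] with t h1 h2 h3
    exact ⟨h1, fun i => ⟨h2 i, h3 i⟩⟩
  have htrunc : ∀ {q : ℝ → StateSpace n → ℝ},
      AEMeasurable (fun z : StateSpace n × ℝ => q z.2 z.1) (volume.prod μ) →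
      (∀ t ∈ good, AEStronglyMeasurable (q t) volume) → (∀ t ∈ good, ∀ x, |q t x| ≤ |K|) →
      (∀ t ∈ good, ∀ i x, LineDifferentiableAt ℝ (q t) x (stdVec i)) →
      (∀ t ∈ good, ∀ i x, |lineDeriv ℝ (q t) x (stdVec i)| ≤ |K|) →
      IsCoefficient 0 T |K| |K| (fun t x => if t ∈ good then q t x else 0) := by
    intro q hq hs hb hd hdb
    refine ⟨?_, fun t => ?_, fun t x => ?_, fun i t x s => ?_⟩
    · refine hq.aestronglyMeasurable.congr ?_
      filter_upwards [Measure.quasiMeasurePreserving_snd.ae hgood] with z hz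
      rw [if_pos hz]
    · by_cases ht : t ∈ good
      · simpa only [if_pos ht] using hs t ht
      · simpa only [if_neg ht] using aestronglyMeasurable_const
    · by_cases ht : t ∈ good
      · simpa only [if_pos ht] using hb t ht x
      · simp [ht]
    · by_cases ht : t ∈ good
      · simp only [if_pos ht]
        exact abs_sub_le_of_lineDeriv (hd t ht i) (hdb t ht i) x s
      · simp only [if_neg ht, sub_self, abs_zero]
        positivity
  have hKK := le_abs_self K
  refine ⟨|K|, fun i t x => if t ∈ good then g i t x else 0,
    fun i t x => if t ∈ good then dg i t x else 0, abs_nonneg K, fun i => ?_, fun i => ?_,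
    fun i t x => ?_, ?_⟩
  · exact htrunc (hf.measurable_field i) (fun t ht => (ht.2 i).1)
      (fun t ht x => (hK t ht.1 x i i i).1.trans hKK)
      (fun t ht j x => hf.exists_first t ht.1 x i j)
      (fun t ht j x => (hK t ht.1 x i j i).2.1.trans hKK)
  -- The second derivatives of `f` enter here: they make `∂ᵢ fᵢ` Lipschitz along the coordinate
  -- directions.
  · exact htrunc (hf.measurable_first i i) (fun t ht => (ht.2 i).2)
      (fun t ht x => (hK t ht.1 x i i i).2.1.trans hKK)
      (fun t ht j x => hf.exists_second t ht.1 x i i j)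
      (fun t ht j x => (hK t ht.1 x i i j).2.2.trans hKK)
  · by_cases ht : t ∈ good
    · simp only [if_pos ht]
      exact (hf.exists_first t ht.1 x i i).hasLineDerivAt
    · simp only [if_neg ht]
      simpa [HasLineDerivAt] using hasDerivAt_const (0 : ℝ) (0 : ℝ)
  · filter_upwards [hgood] with t ht i x
    rw [if_pos ht]

end Coefficients

/-! ### The operators `A` and `A*`: adjointness and energy -/

section Transport

variable {n : ℕ} {T C : ℝ} {f : StateSpace n → ℝ → StateSpace n}
  {β dβ : Fin n → ℝ → StateSpace n → ℝ}

theorem HZero.ae_eq_congr {u v : HZero n} {g : StateSpace n → ℝ} (hu : u =ᵐ[volume] g)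
    (hv : v =ᵐ[volume] g) : u = v := Lp.ext (hu.trans hv.symm)

namespace IsFieldCoefficients

theorem coeFn_sum_mulOp (h : IsFieldCoefficients T C f β dβ) {t : ℝ}
    (ht : ∀ i x, β i t x = f x t i) (w : Fin n → HZero n) :
    (∑ i, mulOp (β i t) (w i) : HZero n) =ᵐ[volume] fun x => ∑ i, f x t i * w i x := by
  filter_upwards [HZero.coeFn_sum fun i => mulOp (β i t) (w i),
    ae_all_iff.2 fun i => coeFn_mulOp ((h.coeff i).memLp t) (w i)] with x h1 h2
  rw [h1]
  simp_rw [h2, ht]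

theorem coeFn_mulOp (h : IsFieldCoefficients T C f β dβ) {t : ℝ}
    (ht : ∀ i x, β i t x = f x t i) (i : Fin n) (u : HZero n) :
    mulOp (β i t) u =ᵐ[volume] fun x => f x t i * u x := by
  filter_upwards [_root_.coeFn_mulOp ((h.coeff i).memLp t) u] with x hx
  rw [hx, ht]

theorem isTransport (h : IsFieldCoefficients T C f β dβ) {t : ℝ}
    (ht : ∀ i x, β i t x = f x t i) {u : HZero n} {w : Fin n → HZero n}
    (hw : ∀ i, HasWeakPartial i u (w i)) : IsTransport f t u (∑ i, mulOp (β i t) (w i)) :=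
  ⟨w, hw, h.coeFn_sum_mulOp ht w⟩

theorem exists_of_isTransport (h : IsFieldCoefficients T C f β dβ) {t : ℝ}
    (ht : ∀ i x, β i t x = f x t i) {u g : HZero n} (hg : IsTransport f t u g) :
    ∃ w : Fin n → HZero n, (∀ i, HasWeakPartial i u (w i)) ∧ g = ∑ i, mulOp (β i t) (w i) := by
  obtain ⟨w, hw, hgw⟩ := hg
  exact ⟨w, hw, HZero.ae_eq_congr hgw (h.coeFn_sum_mulOp ht w)⟩

theorem hasWeakPartial_mulOp (h : IsFieldCoefficients T C f β dβ) (t : ℝ) {i : Fin n}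
    {u w : HZero n} (hw : HasWeakPartial i u w) :
    HasWeakPartial i (mulOp (β i t) u) (mulOp (β i t) w + mulOp (dβ i t) u : HZero n) :=
  hw.mulOp ((h.coeff i).slice t) ((h.dcoeff i).slice t) ((h.coeff i).bdd t)
    ((h.coeff i).lip i t) (h.hasLineDerivAt i t)

theorem isAdjointTransport (h : IsFieldCoefficients T C f β dβ) {t : ℝ}
    (ht : ∀ i x, β i t x = f x t i) {u : HZero n} {w : Fin n → HZero n}
    (hw : ∀ i, HasWeakPartial i u (w i)) :
    IsAdjointTransport f t u (-∑ i, (mulOp (β i t) (w i) + mulOp (dβ i t) u)) := by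
  refine ⟨fun i => mulOp (β i t) (w i) + mulOp (dβ i t) u, fun i =>
    (h.hasWeakPartial_mulOp t (hw i)).congr (h.coeFn_mulOp ht i u) EventuallyEq.rfl, ?_⟩
  filter_upwards [Lp.coeFn_neg (∑ i, (mulOp (β i t) (w i) + mulOp (dβ i t) u)),
    HZero.coeFn_sum fun i => mulOp (β i t) (w i) + mulOp (dβ i t) u] with x h1 h2
  rw [h1, Pi.neg_apply, h2]

theorem exists_of_isAdjointTransport (h : IsFieldCoefficients T C f β dβ) {t : ℝ}
    (ht : ∀ i x, β i t x = f x t i) {u g : HZero n} (hg : IsAdjointTransport f t u g) :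
    ∃ q : Fin n → HZero n, (∀ i, HasWeakPartial i (mulOp (β i t) u) (q i)) ∧ g = -∑ i, q i := by
  obtain ⟨q, hq, hgq⟩ := hg
  refine ⟨q, fun i => (hq i).congr (h.coeFn_mulOp ht i u).symm EventuallyEq.rfl,
    HZero.ae_eq_congr hgq ?_⟩
  filter_upwards [Lp.coeFn_neg (∑ i, q i), HZero.coeFn_sum q] with x h1 h2
  rw [h1, Pi.neg_apply, h2]

/-- `(A u, p) = (u, A* p)`. -/
theorem inner_transport (h : IsFieldCoefficients T C f β dβ) {t : ℝ}
    (ht : ∀ i x, β i t x = f x t i) {u g p k : HZero n} (hg : IsTransport f t u g)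
    (hk : IsAdjointTransport f t p k) : inner ℝ g p = inner ℝ u k := by
  obtain ⟨w, hw, rfl⟩ := h.exists_of_isTransport ht hg
  obtain ⟨q, hq, rfl⟩ := h.exists_of_isAdjointTransport ht hk
  rw [sum_inner, inner_neg_right, inner_sum, ← Finset.sum_neg_distrib]
  refine Finset.sum_congr rfl fun i _ => ?_
  -- Moving the multiplier to `p` requires a weak derivative of the product `βᵢ p` only, not of `p`
  -- itself.
  rw [inner_mulOp_left, (hw i).inner_eq_neg (hq i)]

/-- The energy estimate for `A*`. -/
theorem inner_adjointTransport_le (h : IsFieldCoefficients T C f β dβ) {t : ℝ} {p : HZero n}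
    {w q : Fin n → HZero n} (hw : ∀ i, HasWeakPartial i p (w i))
    (hq : ∀ i, HasWeakPartial i (mulOp (β i t) p) (q i)) :
    inner ℝ (-∑ i, q i) p ≤ n * C * ‖p‖ ^ 2 := by
  rw [inner_neg_left, sum_inner, ← Finset.sum_neg_distrib]
  have hi : ∀ i ∈ Finset.univ, -inner ℝ (q i) p ≤ C * ‖p‖ ^ 2 := by
    intro i _
    -- With `β = βᵢ`, Leibniz gives `(q, p) = (β w, p) + (dβ p, p)` and integration by parts gives
    -- `(q, p) = -(β w, p)`. Adding, `2 (q, p) = (dβ p, p)`: no derivative of `p` remains.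
    have e1 := (hq i).unique (h.hasWeakPartial_mulOp t (hw i))
    have e2 := (hq i).inner_eq_neg (hw i)
    have e3 : inner ℝ (q i) p = inner ℝ (mulOp (β i t) (w i)) p + inner ℝ (mulOp (dβ i t) p) p := by
      rw [e1, inner_add_left]
    have e4 : inner ℝ (mulOp (β i t) p) (w i) = inner ℝ (mulOp (β i t) (w i)) p := by
      rw [inner_mulOp_left, real_inner_comm]
    have e5 := (abs_le.1 (abs_real_inner_le_norm (mulOp (dβ i t) p) p)).1
    have e6 := norm_mulOp_le ((h.dcoeff i).bdd t) p
    have e7 : ‖mulOp (dβ i t) p‖ * ‖p‖ ≤ C * ‖p‖ ^ 2 := by nlinarith [norm_nonneg p]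
    have e8 : 0 ≤ C * ‖p‖ ^ 2 := mul_nonneg h.nonneg (sq_nonneg _)
    linarith
  refine (Finset.sum_le_sum hi).trans_eq ?_
  rw [Finset.sum_const, Finset.card_univ, Fintype.card_fin, nsmul_eq_mul, mul_assoc]

end IsFieldCoefficients

theorem IsTest.hasWeakPartial {ψ : StateSpace n → ℝ} (h : IsTest ψ) (i : Fin n) :
    HasWeakPartial i h.toH (h.pderiv i).toH := by
  rw [hasWeakPartial_iff]
  intro χ hχ
  refine tendsto_nhds_unique ((tendsto_const_nhds (x := h.toH)).inner (𝕜 := ℝ)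
    (hχ.tendsto_diffQuot i)) ?_
  refine (((h.tendsto_diffQuot i).inner (𝕜 := ℝ) (tendsto_const_nhds (x := hχ.toH))).neg).congr
    fun k => ?_
  rw [inner_diffQuot_left, neg_neg]

/-- Exponential growth bound for solutions of differential inequalities in Hilbert space. -/
theorem IsPrimitive.norm_le_exp {H : Type*} [NormedAddCommGroup H] [InnerProductSpace ℝ H]
    [CompleteSpace H] {a b C : ℝ} {u g : ℝ → H} (h : IsPrimitive a b u g)
    (hg : ∀ᵐ t ∂(volume.restrict (Icc a b)), inner ℝ (g t) (u t) ≤ C * ‖u t‖ ^ 2) {t : ℝ}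
    (ht : t ∈ Icc a b) : ‖u t‖ ≤ Real.exp (C * (t - a)) * ‖u a‖ := by
  have hab : a ≤ b := ht.1.trans ht.2
  have hv := h.exp_smul (-C)
  set v : ℝ → H := fun t => Real.exp (-C * t) • u t with hvdef
  have hvv := (hv.bilin (innerSL ℝ) hv).sub_eq ⟨le_rfl, hab⟩ ht
  have hle : inner ℝ (v t) (v t) - inner ℝ (v a) (v a) ≤ 0 := by
    refine le_of_eq_of_le hvv ?_
    rw [intervalIntegral.integral_of_le ht.1]
    refine integral_nonpos_of_ae ?_
    have hsub : Ioc a t ⊆ Icc a b := Ioc_subset_Icc_self.trans (Icc_subset_Icc_right ht.2)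
    filter_upwards [ae_restrict_of_ae_restrict_of_subset hsub hg] with τ hτ
    change inner ℝ (v τ) _ + inner ℝ _ (v τ) ≤ 0
    rw [real_inner_comm (v τ)]
    have e : inner ℝ (Real.exp (-C * τ) • (g τ + -C • u τ)) (v τ) =
        Real.exp (-C * τ) ^ 2 * (inner ℝ (g τ) (u τ) - C * ‖u τ‖ ^ 2) := by
      rw [hvdef]
      simp only [real_inner_smul_left, real_inner_smul_right, inner_add_left,
        real_inner_self_eq_norm_sq]
      ring
    have : Real.exp (-C * τ) ^ 2 * (inner ℝ (g τ) (u τ) - C * ‖u τ‖ ^ 2) ≤ 0 :=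
      mul_nonpos_of_nonneg_of_nonpos (sq_nonneg _) (by linarith)
    rw [real_inner_comm, e]
    linarith
  rw [real_inner_self_eq_norm_sq, real_inner_self_eq_norm_sq, sub_nonpos] at hle
  have h1 := abs_le_of_sq_le_sq hle (norm_nonneg _)
  have h2 : ‖v t‖ ≤ ‖v a‖ := (le_abs_self _).trans h1
  simp only [hvdef, norm_smul, Real.norm_eq_abs, Real.abs_exp] at h2
  calc ‖u t‖ = Real.exp (C * t) * (Real.exp (-C * t) * ‖u t‖) := by
        rw [← mul_assoc, ← Real.exp_add]; simp
    _ ≤ Real.exp (C * t) * (Real.exp (-C * a) * ‖u a‖) := by gcongr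
    _ = Real.exp (C * (t - a)) * ‖u a‖ := by
        rw [← mul_assoc, ← Real.exp_add]; congr 2; ring

end Transport

/-! ### Duality, stability and solvability of the two Cauchy problems -/

section Solutions

variable {n : ℕ} {s T C : ℝ} {f : StateSpace n → ℝ → StateSpace n}
  {β dβ : Fin n → ℝ → StateSpace n → ℝ}

/-- The continuous map on `[a,b]` given by a primitive. -/
def IsPrimitive.toContinuousMap {E : Type*} [NormedAddCommGroup E] [NormedSpace ℝ E]
    [CompleteSpace E] {a b : ℝ} {u g : ℝ → E} (h : IsPrimitive a b u g) : C(Icc a b, E) :=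
  ⟨(Icc a b).domRestrict u, h.continuousOn.domRestrict⟩

theorem IsPrimitive.iccExtend {E : Type*} [NormedAddCommGroup E] [NormedSpace ℝ E]
    [CompleteSpace E] {a b : ℝ} {u g : ℝ → E} (h : IsPrimitive a b u g) (hab : a ≤ b) {t : ℝ}
    (ht : t ∈ Icc a b) : IccExtend hab h.toContinuousMap t = u t := by
  rw [IccExtend_of_mem _ _ ht]; rfl

theorem SolvesForward.exists_isPrimitive {hsT : s ≤ T} {ρs : HZero n} {p : CZero n s T}
    (h : SolvesForward hsT f ρs p) : ∃ g : ℝ → HZero n, IsPrimitive s T (IccExtend hsT p) g ∧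
      IccExtend hsT p s = ρs ∧
      ∀ᵐ t ∂(volume.restrict (Icc s T)), IsAdjointTransport f t (IccExtend hsT p t) (g t) := by
  obtain ⟨-, g, hg, hA, hp⟩ := h
  have h0 : IccExtend hsT p s = ρs := by
    rw [IccExtend_of_mem _ _ (left_mem_Icc.2 hsT), hp]; simp
  refine ⟨g, ⟨hg, fun t ht => ?_⟩, h0, hA⟩
  rw [h0, IccExtend_of_mem _ _ ht, hp]

theorem SolvesBackward.exists_isPrimitive {hT : 0 ≤ T} {φ : ℝ → HZero n} {v : CZero n 0 T}
    (hφ : IntegrableOn φ (Icc 0 T)) (h : SolvesBackward hT f φ v) :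
    ∃ g : ℝ → HZero n, IsPrimitive 0 T (IccExtend hT v) (fun t => -(g t + φ t)) ∧ IccExtend hT v T = 0 ∧
      ∀ᵐ t ∂(volume.restrict (Icc 0 T)), IsTransport f t (IccExtend hT v t) (g t) := by
  obtain ⟨-, g, hg, hA, hv⟩ := h
  refine ⟨g, ⟨(hg.add hφ).neg, fun t ht => ?_⟩, ?_, hA⟩
  · have hi : ∀ {a b : ℝ}, a ∈ Icc 0 T → b ∈ Icc 0 T →
        IntervalIntegrable (fun t => g t + φ t) volume a b := fun ha hb =>
      ((hg.add hφ).mono_set (uIcc_subset_Icc ha hb)).intervalIntegrable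
    rw [IccExtend_of_mem _ _ ht, IccExtend_of_mem _ _ (left_mem_Icc.2 hT), hv, hv,
      intervalIntegral.integral_neg, ← sub_eq_add_neg, eq_sub_iff_add_eq, add_comm]
    exact intervalIntegral.integral_add_adjacent_intervals (hi (left_mem_Icc.2 hT) ht)
      (hi ht (right_mem_Icc.2 hT))
  · rw [IccExtend_of_mem _ _ (right_mem_Icc.2 hT), hv]; simp

theorem MemXOne.exists_ae_hasWeakPartial {a b : ℝ} {u : ℝ → HZero n} (h : MemXOne a b u) :
    ∀ᵐ t ∂(volume.restrict (Icc a b)), ∃ w : Fin n → HZero n, ∀ i, HasWeakPartial i (u t) (w i) := by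
  choose w _ hw using h.2
  filter_upwards [ae_all_iff.2 hw] with t ht using ⟨fun i => w i t, ht⟩

theorem MemXOne.congr {a b : ℝ} {u u' : ℝ → HZero n} (h : MemXOne a b u)
    (hu : u =ᵐ[volume.restrict (Icc a b)] u') : MemXOne a b u' := by
  refine ⟨(memLp_congr_ae hu).1 h.1, fun i => ?_⟩
  obtain ⟨w, hw, hw'⟩ := h.2 i
  refine ⟨w, hw, ?_⟩
  filter_upwards [hw', hu] with t h1 h2
  rwa [← h2]

theorem MemXOne.add {a b : ℝ} {u u' : ℝ → HZero n} (h : MemXOne a b u) (h' : MemXOne a b u') :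
    MemXOne a b (u + u') := by
  refine ⟨h.1.add h'.1, fun i => ?_⟩
  obtain ⟨w, hw, hw'⟩ := h.2 i
  obtain ⟨y, hy, hy'⟩ := h'.2 i
  refine ⟨w + y, hw.add hy, ?_⟩
  filter_upwards [hw', hy'] with t h1 h2 using h1.add h2

/-- Duality between solutions of the backward and the forward problem. -/
theorem IsFieldCoefficients.inner_eq_integral (h : IsFieldCoefficients T C f β dβ) (hT : 0 ≤ T)
    (hs : s ∈ Icc 0 T) {φ : ℝ → HZero n} (hφ : IntegrableOn φ (Icc 0 T)) {v : CZero n 0 T}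
    (hv : SolvesBackward hT f φ v) {ρs : HZero n} {p : CZero n s T}
    (hp : SolvesForward hs.2 f ρs p) :
    inner ℝ (v ⟨s, hs⟩) ρs = ∫ t in s..T, inner ℝ (φ t) (IccExtend hs.2 p t) := by
  obtain ⟨g, hvP, hvT, hvA⟩ := hv.exists_isPrimitive hφ
  obtain ⟨k, hpP, hps, hpA⟩ := hp.exists_isPrimitive
  have hI : Icc s T ⊆ Icc 0 T := Icc_subset_Icc_left hs.1
  have hprod := ((hvP.mono hs).bilin (innerSL ℝ) hpP).sub_eq (left_mem_Icc.2 hs.2)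
    (right_mem_Icc.2 hs.2)
  rw [hvT, hps, IccExtend_of_mem _ _ hs] at hprod
  have h1 : -inner ℝ (v ⟨s, hs⟩) ρs = ∫ t in s..T, -inner ℝ (φ t) (IccExtend hs.2 p t) := by
    refine (Eq.trans (by rw [map_zero, _root_.zero_apply, zero_sub]; rfl) hprod).trans ?_
    rw [intervalIntegral.integral_of_le hs.2, intervalIntegral.integral_of_le hs.2,
      ← integral_Icc_eq_integral_Ioc, ← integral_Icc_eq_integral_Ioc]
    refine integral_congr_ae ?_
    filter_upwards [hpA, ae_restrict_of_ae_restrict_of_subset hI hvA,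
      ae_restrict_of_ae_restrict_of_subset hI h.ae_eq] with t h1 h2 h3
    -- The terms `(v, A* p)` and `(A v, p)` cancel, leaving `-(φ, p)`.
    change inner ℝ _ (k t) + inner ℝ (-(g t + φ t)) _ = _
    rw [inner_neg_left, inner_add_left, h.inner_transport h3 h2 h1]
    ring
  rw [intervalIntegral.integral_neg, neg_inj] at h1
  exact h1

/-- Stability of the forward problem. -/
theorem IsFieldCoefficients.norm_sub_le_of_solvesForward (h : IsFieldCoefficients T C f β dβ)
    (hs : s ∈ Icc 0 T) {ρ ρ' : HZero n} {p p' : CZero n s T} (hp : SolvesForward hs.2 f ρ p)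
    (hp' : SolvesForward hs.2 f ρ' p') : ‖p - p'‖ ≤ Real.exp (n * C * T) * ‖ρ - ρ'‖ := by
  obtain ⟨k, hP, h0, hA⟩ := hp.exists_isPrimitive
  obtain ⟨k', hP', h0', hA'⟩ := hp'.exists_isPrimitive
  have hI : Icc s T ⊆ Icc 0 T := Icc_subset_Icc_left hs.1
  set u := IccExtend hs.2 p
  set u' := IccExtend hs.2 p'
  have hsub : IsPrimitive s T (fun t => u t - u' t) (fun t => k t - k' t) := by
    refine ⟨hP.integrableOn.sub hP'.integrableOn, fun t ht => ?_⟩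
    rw [intervalIntegral.integral_sub (hP.intervalIntegrable (left_mem_Icc.2 hs.2) ht)
      (hP'.intervalIntegrable (left_mem_Icc.2 hs.2) ht), hP.eq_add t ht, hP'.eq_add t ht]
    abel
  have hen : ∀ᵐ t ∂(volume.restrict (Icc s T)),
      inner ℝ (k t - k' t) (u t - u' t) ≤ n * C * ‖u t - u' t‖ ^ 2 := by
    filter_upwards [hA, hA', hp.1.exists_ae_hasWeakPartial, hp'.1.exists_ae_hasWeakPartial,
      ae_restrict_of_ae_restrict_of_subset hI h.ae_eq] with t h1 h2 h3 h4 h5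
    obtain ⟨q, hq, hk⟩ := h.exists_of_isAdjointTransport h5 h1
    obtain ⟨q', hq', hk'⟩ := h.exists_of_isAdjointTransport h5 h2
    obtain ⟨w, hw⟩ := h3
    obtain ⟨w', hw'⟩ := h4
    have e : k t - k' t = -∑ i, (q i - q' i) := by
      rw [hk, hk', Finset.sum_sub_distrib]; abel
    rw [e]
    refine h.inner_adjointTransport_le (t := t) (fun i => (hw i).sub (hw' i)) fun i => ?_
    rw [map_sub]
    exact (hq i).sub (hq' i)
  rw [ContinuousMap.norm_le _ (by positivity)]
  rintro ⟨t, ht⟩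
  have h1 := hsub.norm_le_exp hen ht
  simp only [u, u', IccExtend_of_mem _ _ ht] at h1
  rw [show IccExtend hs.2 (⇑p) s = ρ from h0, show IccExtend hs.2 (⇑p') s = ρ' from h0'] at h1
  refine h1.trans ?_
  gcongr
  · exact mul_nonneg (Nat.cast_nonneg n) h.nonneg
  · linarith [ht.2, hs.1]

/-- Solvability of the forward problem for smooth data. -/
theorem IsFieldCoefficients.exists_solvesForward (h : IsFieldCoefficients T C f β dβ)
    (hs : s ∈ Icc 0 T) {ψ : StateSpace n → ℝ} (hψ : IsTest ψ) :
    ∃ p : CZero n s T, SolvesForward hs.2 f hψ.toH p := by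
  have hI : Icc s T ⊆ Icc 0 T := Icc_subset_Icc_left hs.1
  -- A common bound for the `βᵢ` and for the divergence `∑ dβᵢ`, whose `n` summands are each bounded
  -- by `C`.
  set K := max C (n * C) with hK
  have hCK : C ≤ K := le_max_left _ _
  have hK0 : 0 ≤ K := h.nonneg.trans hCK
  have hb : ∀ i, IsCoefficient s T K K (fun t x => -β i t x) := fun i =>
    ((h.coeff i).mono hI hCK hCK).neg
  have hc : IsCoefficient s T K K (fun t x => -∑ i, dβ i t x) := by
    have := (IsCoefficient.sum h.dcoeff).neg
    rw [Fintype.card_fin] at this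
    exact this.mono hI (le_max_right _ _) (le_max_right _ _)
  have hcE : ∀ t (y : HZero n), mulOp (fun x => -∑ i, dβ i t x) y = -∑ i, mulOp (dβ i t) y := by
    intro t y
    rw [mulOp_neg (memLp_finsetSum Finset.univ fun i _ => (h.dcoeff i).memLp t),
      mulOp_sum fun i => (h.dcoeff i).memLp t]
  have hbE : ∀ i t (y : HZero n), mulOp (fun x => -β i t x) y = -mulOp (β i t) y :=
    fun i t y => mulOp_neg ((h.coeff i).memLp t) y
  have hconst : ∀ y : HZero n, MemLp (fun _ : ℝ => y) 2 (volume.restrict (Icc s T)) :=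
    fun y => memLp_const y
  -- The unknown is `u = p - ψ`, which starts from zero and has the source `A* ψ`. Bounding the
  -- difference quotients of this source involves second derivatives of `ψ`.
  have hφ : MemLp (fun t => ∑ i, mulOp (fun x => -β i t x) (hψ.pderiv i).toH +
      mulOp (fun x => -∑ i, dβ i t x) hψ.toH) 2 (volume.restrict (Icc s T)) :=
    (memLp_finsetSum Finset.univ fun i _ => (hb i).isOpFamily.memLp (hconst _)).add
      (hc.isOpFamily.memLp (hconst _))
  have hD : ∀ {c : ℝ → StateSpace n → ℝ}, IsCoefficient s T K K c → ∀ {χ : StateSpace n → ℝ}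
      (hχ : IsTest χ) t k j, ‖diffQuot j (step k) (mulOp (c t) hχ.toH)‖ ≤
        K * ‖hχ.toH‖ + K * ∑ j, ‖(hχ.pderiv j).toH‖ := by
    intro c hc χ hχ t k j
    have h1 := norm_diffQuot_mulOp_sub_le (hc.slice t) (hc.bdd t) (hc.lip j t) (step_pos k).ne' hχ.toH
    have h2 := norm_mulOp_le (hc.bdd t) (diffQuot j (step k) hχ.toH)
    have h3 := (hχ.hasWeakPartial j).norm_diffQuot_le (step_pos k)
    have h4 := Finset.single_le_sum (f := fun j => ‖(hχ.pderiv j).toH‖)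
      (fun _ _ => norm_nonneg _) (Finset.mem_univ j)
    have h5 := norm_le_norm_sub_add (diffQuot j (step k) (mulOp (c t) hχ.toH))
      (mulOp (c t) (diffQuot j (step k) hχ.toH))
    have h6 : K * ‖diffQuot j (step k) hχ.toH‖ ≤ K * ∑ j, ‖(hχ.pderiv j).toH‖ := by
      gcongr; exact h3.trans h4
    linarith
  obtain ⟨u, g, w, hP, hu0, hw, hae⟩ := exists_forward_evolution hs.2 hb hc hK0 hφ
    (r := fun _ => ∑ i, (K * ‖(hψ.pderiv i).toH‖ + K * ∑ j, ‖((hψ.pderiv i).pderiv j).toH‖) +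
      (K * ‖hψ.toH‖ + K * ∑ j, ‖(hψ.pderiv j).toH‖)) (memLp_const _)
    (Eventually.of_forall fun t k j => by
      rw [map_add, map_sum]
      refine (norm_add_le _ _).trans (add_le_add ((norm_sum_le _ _).trans
        (Finset.sum_le_sum fun i _ => hD (hb i) _ t k j)) (hD hc _ t k j))
    )
  have hQ : IsPrimitive s T (fun t => hψ.toH + u t) g := ⟨hP.integrableOn, fun t ht => by
    rw [hP.eq_add t ht, add_assoc]⟩
  have hae' : ∀ᵐ t ∂(volume.restrict (Icc s T)), ∀ i,
      HasWeakPartial i (hψ.toH + u t : HZero n) ((hψ.pderiv i).toH + w i t : HZero n) := by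
    filter_upwards [hae] with t ht i using (hψ.hasWeakPartial i).add (ht.1 i)
  refine ⟨hQ.toContinuousMap, ⟨?_, fun i => ⟨fun t => (hψ.pderiv i).toH + w i t,
    (hconst _).add (hw i), ?_⟩⟩, g, hP.integrableOn, ?_, ?_⟩
  · refine (memLp_congr_ae ?_).1 (hQ.memLp 2)
    filter_upwards [ae_restrict_mem (μ := volume) (measurableSet_Icc (a := s) (b := T))] with t ht
    rw [hQ.iccExtend hs.2 ht]
  · filter_upwards [hae', ae_restrict_mem (μ := volume) (measurableSet_Icc (a := s) (b := T))]
      with t h1 ht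
    rw [hQ.iccExtend hs.2 ht]
    exact h1 i
  · filter_upwards [hae, hae', ae_restrict_mem (μ := volume) (measurableSet_Icc (a := s) (b := T)),
      ae_restrict_of_ae_restrict_of_subset hI h.ae_eq] with t h1 h2 ht h3
    rw [hQ.iccExtend hs.2 ht]
    have e : g t = -∑ i, (mulOp (β i t) ((hψ.pderiv i).toH + w i t) +
        mulOp (dβ i t) (hψ.toH + u t)) := by
      rw [h1.2]
      simp only [hbE, hcE, map_add, Finset.sum_add_distrib, Finset.sum_neg_distrib]
      abel
    rw [e]
    exact h.isAdjointTransport h3 h2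
  · rintro ⟨t, ht⟩
    have := hQ.eq_add t ht
    simp only [hu0, add_zero] at this
    exact this

/-- Solvability of the backward problem. -/
theorem IsFieldCoefficients.exists_solvesBackward (h : IsFieldCoefficients T C f β dβ)
    (hT : 0 ≤ T) {φ : ℝ → HZero n} (hφ : MemXOne 0 T φ) :
    ∃ v : CZero n 0 T, SolvesBackward hT f φ v := by
  choose y hy hyw using hφ.2
  obtain ⟨u, g, w, hP, hu0, hw, hae⟩ := exists_backward_evolution hT h.coeff
    (IsCoefficient.zero h.nonneg h.nonneg) h.nonneg hφ.1 (r := fun t => ∑ i, ‖y i t‖)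
    (memLp_finsetSum Finset.univ fun i _ => (hy i).norm) (by
      filter_upwards [ae_all_iff.2 hyw] with t ht k j
      exact ((ht j).norm_diffQuot_le (step_pos k)).trans (Finset.single_le_sum
        (f := fun j => ‖y j t‖) (fun _ _ => norm_nonneg _) (Finset.mem_univ j)))
  have hmem : ∀ᵐ t ∂(volume.restrict (Icc 0 T)), t ∈ Icc 0 T :=
    ae_restrict_mem measurableSet_Icc
  have hφi : IntegrableOn φ (Icc 0 T) := hφ.1.integrable (by norm_num)
  -- Here `g` is the time derivative of `u`, so `A u = -g - φ`.
  refine ⟨hP.toContinuousMap, ⟨?_, fun i => ⟨w i, hw i, ?_⟩⟩, fun t => -g t - φ t,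
    hP.integrableOn.neg.sub hφi, ?_, ?_⟩
  · refine (memLp_congr_ae ?_).1 (hP.memLp 2)
    filter_upwards [hmem] with t ht
    rw [hP.iccExtend hT ht]
  · filter_upwards [hae, hmem] with t h1 ht
    rw [hP.iccExtend hT ht]
    exact h1.1 i
  · filter_upwards [hae, hmem, h.ae_eq] with t h1 ht h3
    rw [hP.iccExtend hT ht]
    have e : -g t - φ t = ∑ i, mulOp (β i t) (w i t) := by
      have hz : mulOp (fun _ => (0 : ℝ)) (u t) = 0 := by
        have := norm_mulOp_le (b := fun _ => (0 : ℝ)) (K := 0) (fun _ => by simp) (u t)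
        rw [zero_mul] at this
        exact norm_le_zero_iff.1 this
      rw [h1.2, hz]
      abel
    rw [e]
    exact h.isTransport h3 h1.1
  · rintro ⟨t, ht⟩
    have := hP.sub_eq ht (right_mem_Icc.2 hT)
    rw [hu0, zero_sub, neg_eq_iff_eq_neg] at this
    simp only [sub_add_cancel, intervalIntegral.integral_neg]
    exact this

theorem memXOne_indicatorConstLp {a b : ℝ} {ψ : StateSpace n → ℝ} (hψ : IsTest ψ) {E : Set ℝ}
    (hE : MeasurableSet E) (hμ : volume.restrict (Icc a b) E ≠ ⊤) :
    MemXOne a b (indicatorConstLp 1 hE hμ hψ.toH) := by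
  have h : MemXOne a b (E.indicator fun _ => hψ.toH) := by
    refine ⟨memLp_indicator_const 2 hE _ (Or.inr hμ), fun i =>
      ⟨E.indicator fun _ => (hψ.pderiv i).toH, memLp_indicator_const 2 hE _ (Or.inr hμ),
        Eventually.of_forall fun t => ?_⟩⟩
    by_cases ht : t ∈ E
    · simp only [indicator_of_mem ht]
      exact hψ.hasWeakPartial i
    · simp only [indicator_of_notMem ht]
      rw [hasWeakPartial_iff]
      simp
  exact h.congr indicatorConstLp_coeFn.symm

/-- `X¹` is dense in `X₁⁰`. -/
theorem dense_memXOne (n : ℕ) (T : ℝ) : Dense {φ : XOneZero n T | MemXOne 0 T φ} := by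
  intro φ
  refine Lp.induction (p := 1) (by simp)
    (motive := fun φ : XOneZero n T => φ ∈ closure {φ : XOneZero n T | MemXOne 0 T φ})
    ?_ ?_ isClosed_closure φ
  · intro c E hE hμ
    change indicatorConstLp 1 hE hμ.ne c ∈ _
    have hcont : Continuous fun c : HZero n =>
        (indicatorConstLp 1 hE hμ.ne c : XOneZero n T) := by
      refine continuous_iff_continuousAt.2 fun c => tendsto_iff_norm_sub_tendsto_zero.2 ?_
      have h1 : Tendsto (fun c' : HZero n => ‖c' - c‖ *
          (volume.restrict (Icc 0 T)).real E ^ (1 / (1 : ENNReal).toReal)) (𝓝 c) (𝓝 0) := by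
        have := (tendsto_iff_norm_sub_tendsto_zero.1 (tendsto_id (x := 𝓝 c))).mul_const
          ((volume.restrict (Icc 0 T)).real E ^ (1 / (1 : ENNReal).toReal))
        rwa [zero_mul] at this
      refine squeeze_zero (fun _ => norm_nonneg _) (fun c' => ?_) h1
      rw [indicatorConstLp_sub]
      exact norm_indicatorConstLp_le
    refine dense_range_toH.induction
      (P := fun c => (indicatorConstLp 1 hE hμ.ne c : XOneZero n T) ∈ _) ?_
      (isClosed_closure.preimage hcont) c
    rintro _ ⟨ψ, hψ, rfl⟩
    exact subset_closure (memXOne_indicatorConstLp hψ hE hμ.ne)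
  · intro F G hF hG _ h1 h2
    refine map_mem_closure₂ continuous_add h1 h2 fun x hx y hy => ?_
    exact (MemXOne.add hx hy).congr (Lp.coeFn_add x y).symm

/-! ### The time pairing and the closures of the solution graphs -/

/-- The pairing `∫_s^T (φ, p)`. -/
noncomputable def timePairing (hs : s ∈ Icc 0 T) (φ : XOneZero n T) (p : CZero n s T) : ℝ :=
  ∫ t in s..T, inner ℝ (φ t) (IccExtend hs.2 p t)

theorem norm_iccExtend_le {hsT : s ≤ T} (p : CZero n s T) (t : ℝ) : ‖IccExtend hsT p t‖ ≤ ‖p‖ :=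
  p.norm_coe_le_norm _

theorem XOneZero.integrableOn (hs : s ∈ Icc 0 T) (φ : XOneZero n T) :
    IntegrableOn φ (Icc s T) :=
  IntegrableOn.mono_set ((Lp.memLp φ).integrable le_rfl) (Icc_subset_Icc_left hs.1)

theorem intervalIntegrable_timePairing (hs : s ∈ Icc 0 T) (φ : XOneZero n T) (p : CZero n s T) :
    IntervalIntegrable (fun t => inner ℝ (φ t) (IccExtend hs.2 p t)) volume s T := by
  refine IntegrableOn.intervalIntegrable ?_
  rw [uIcc_of_le hs.2]
  have hφ := XOneZero.integrableOn hs φ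
  refine Integrable.mono' (hφ.norm.mul_const ‖p‖) (hφ.aestronglyMeasurable.inner
    (p.continuous.Icc_extend' (h := hs.2)).aestronglyMeasurable) (Eventually.of_forall fun t => ?_)
  exact (norm_inner_le_norm _ _).trans (by gcongr; exact norm_iccExtend_le p t)

/-- Hölder's inequality in time with exponents `1` and `∞`. It gives continuity in each argument and
the backward estimate in the `L¹` norm of the source. -/
theorem abs_timePairing_le (hs : s ∈ Icc 0 T) (φ : XOneZero n T) (p : CZero n s T) :
    |timePairing hs φ p| ≤ ‖φ‖ * ‖p‖ := by
  have h1 : ‖φ‖ = ∫ t in Icc 0 T, ‖φ t‖ := L1.norm_eq_integral_norm φ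
  have hφ : IntegrableOn φ (Icc 0 T) := (Lp.memLp φ).integrable le_rfl
  rw [timePairing, h1, ← integral_mul_const]
  refine (intervalIntegral.norm_integral_le_integral_norm
    (f := fun t => inner ℝ (φ t) (IccExtend hs.2 p t)) (μ := volume) hs.2).trans ?_
  rw [intervalIntegral.integral_of_le hs.2]
  have hsub : Ioc s T ⊆ Icc 0 T := Ioc_subset_Icc_self.trans (Icc_subset_Icc_left hs.1)
  refine le_trans ?_ (setIntegral_mono_set (hφ.norm.mul_const _)
    (Eventually.of_forall fun _ => by positivity) hsub.eventuallyLE)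
  have hint := (intervalIntegrable_iff_integrableOn_Ioc_of_le hs.2).1
    (intervalIntegrable_timePairing hs φ p)
  refine integral_mono hint.norm ((hφ.mono_set hsub).norm.mul_const _) fun t => ?_
  exact (norm_inner_le_norm _ _).trans (by gcongr; exact norm_iccExtend_le p t)

theorem timePairing_sub_left (hs : s ∈ Icc 0 T) (φ φ' : XOneZero n T) (p : CZero n s T) :
    timePairing hs (φ - φ') p = timePairing hs φ p - timePairing hs φ' p := by
  rw [timePairing, timePairing, timePairing, ← intervalIntegral.integral_sub
    (intervalIntegrable_timePairing hs φ p) (intervalIntegrable_timePairing hs φ' p)]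
  refine intervalIntegral.integral_congr_ae_restrict ?_
  have hsub : uIoc s T ⊆ Icc 0 T := by
    rw [uIoc_of_le hs.2]; exact Ioc_subset_Icc_self.trans (Icc_subset_Icc_left hs.1)
  filter_upwards [ae_restrict_of_ae_restrict_of_subset hsub (Lp.coeFn_sub φ φ')] with t ht
  rw [ht, Pi.sub_apply, inner_sub_left]

theorem timePairing_sub_right (hs : s ∈ Icc 0 T) (φ : XOneZero n T) (p p' : CZero n s T) :
    timePairing hs φ (p - p') = timePairing hs φ p - timePairing hs φ p' := by
  rw [timePairing, timePairing, timePairing, ← intervalIntegral.integral_sub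
    (intervalIntegrable_timePairing hs φ p) (intervalIntegrable_timePairing hs φ p')]
  refine intervalIntegral.integral_congr fun t _ => ?_
  simp only [IccExtend, Function.comp, ContinuousMap.sub_apply, inner_sub_right]

theorem continuous_timePairing_left (hs : s ∈ Icc 0 T) (p : CZero n s T) :
    Continuous fun φ : XOneZero n T => timePairing hs φ p :=
  LipschitzWith.continuous (K := ‖p‖₊) <| LipschitzWith.of_dist_le_mul fun φ φ' => by
    rw [Real.dist_eq, dist_eq_norm, ← timePairing_sub_left, coe_nnnorm, mul_comm]
    exact abs_timePairing_le hs _ p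

theorem continuous_timePairing_right (hs : s ∈ Icc 0 T) (φ : XOneZero n T) :
    Continuous fun p : CZero n s T => timePairing hs φ p :=
  LipschitzWith.continuous (K := ‖φ‖₊) <| LipschitzWith.of_dist_le_mul fun p p' => by
    rw [Real.dist_eq, dist_eq_norm, ← timePairing_sub_right, coe_nnnorm]
    exact abs_timePairing_le hs φ _

/-- Stability of the backward problem, by duality. -/
theorem IsFieldCoefficients.norm_sub_le_of_mem_backwardGraph (h : IsFieldCoefficients T C f β dβ)
    (hT : 0 ≤ T) {z z' : XOneZero n T × CZero n 0 T} (hz : z ∈ backwardGraph hT f)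
    (hz' : z' ∈ backwardGraph hT f) :
    ‖z.2 - z'.2‖ ≤ Real.exp (n * C * T) * ‖z.1 - z'.1‖ := by
  set M := Real.exp (n * C * T)
  have hφ : ∀ φ : XOneZero n T, IntegrableOn φ (Icc 0 T) := fun φ =>
    (Lp.memLp φ).integrable le_rfl
  rw [ContinuousMap.norm_le _ (by positivity)]
  rintro ⟨s, hs⟩
  set y : HZero n := (z.2 - z'.2) ⟨s, hs⟩
  have hall : ∀ x : HZero n, inner ℝ y x ≤ M * ‖z.1 - z'.1‖ * ‖x‖ := by
    intro x
    refine dense_range_toH.induction (P := fun x => inner ℝ y x ≤ M * ‖z.1 - z'.1‖ * ‖x‖)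
      ?_ (isClosed_le (by fun_prop) (by fun_prop)) x
    rintro _ ⟨ψ, hψ, rfl⟩
    obtain ⟨p, hp⟩ := h.exists_solvesForward hs hψ
    -- Comparison with the zero solution turns forward stability into the bound `‖p‖ ≤ M ‖ψ‖`.
    have hzero : SolvesForward hs.2 f (0 : HZero n) (0 : CZero n s T) := by
      have hw : ∀ i : Fin n, HasWeakPartial i (0 : HZero n) (0 : HZero n) := fun i => by
        rw [hasWeakPartial_iff]; simp
      have h0 : IccExtend hs.2 (0 : CZero n s T) = fun _ => 0 := rfl
      refine ⟨⟨by rw [h0]; exact memLp_const 0, fun i => ⟨fun _ => 0, memLp_const 0,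
        Eventually.of_forall fun t => hw i⟩⟩, fun _ => 0, integrableOn_zero, ?_, fun t => by simp⟩
      filter_upwards [ae_restrict_of_ae_restrict_of_subset (Icc_subset_Icc_left hs.1) h.ae_eq]
        with t ht
      have := h.isAdjointTransport ht hw
      change IsAdjointTransport f t (0 : HZero n) 0
      simpa using this
    have h1 := h.norm_sub_le_of_solvesForward hs hp hzero
    rw [sub_zero, sub_zero] at h1
    have h2 : inner ℝ y hψ.toH = timePairing hs (z.1 - z'.1) p := by
      rw [timePairing_sub_left]
      change inner ℝ (z.2 ⟨s, hs⟩ - z'.2 ⟨s, hs⟩) _ = _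
      rw [inner_sub_left, h.inner_eq_integral hT hs (hφ _) hz.2 hp,
        h.inner_eq_integral hT hs (hφ _) hz'.2 hp]
      rfl
    rw [h2]
    refine (le_abs_self _).trans ((abs_timePairing_le hs _ p).trans ?_)
    calc ‖z.1 - z'.1‖ * ‖p‖ ≤ ‖z.1 - z'.1‖ * (M * ‖hψ.toH‖) := by gcongr
      _ = _ := by ring
  have h1 := hall y
  rw [real_inner_self_eq_norm_sq] at h1
  rcases (norm_nonneg y).eq_or_lt with h | h
  · rw [← h]; positivity
  · refine le_of_mul_le_mul_right ?_ h
    linarith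

/-- The choice defining `operatorL` is meaningful only if some admissible value exists. Stability,
density of `X¹` and solvability for every `φ ∈ X¹` supply one. -/
theorem mem_closure_backwardGraph (hT : 0 ≤ T) (hf : RegularField T f) (φ : XOneZero n T) :
    (φ, operatorL hT f φ) ∈ closure (backwardGraph hT f) := by
  obtain ⟨C, β, dβ, h⟩ := hf.exists_coefficients
  refine Classical.epsilon_spec (p := fun v => (φ, v) ∈ closure (backwardGraph hT f))
    (exists_mem_closure_of_stable _ _
      (fun z hz z' hz' => h.norm_sub_le_of_mem_backwardGraph hT hz hz') ?_ φ)
  refine (dense_memXOne n T).mono fun φ hφ => ?_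
  obtain ⟨v, hv⟩ := h.exists_solvesBackward hT hφ
  exact ⟨(φ, v), ⟨hφ, hv⟩, rfl⟩

/-- Here smooth compactly supported initial data already form a dense set, so solvability on all of
`H¹` is not needed. -/
theorem mem_closure_forwardGraph (hs : s ∈ Icc 0 T) (hf : RegularField T f) (ρ : HZero n) :
    (ρ, operatorLstar hs.2 f ρ) ∈ closure (forwardGraph hs.2 f) := by
  obtain ⟨C, β, dβ, h⟩ := hf.exists_coefficients
  refine Classical.epsilon_spec (p := fun p => (ρ, p) ∈ closure (forwardGraph hs.2 f))
    (exists_mem_closure_of_stable _ _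
      (fun z hz z' hz' => h.norm_sub_le_of_solvesForward hs hz.2 hz'.2) ?_ ρ)
  refine dense_range_toH.mono ?_
  rintro _ ⟨ψ, hψ, rfl⟩
  obtain ⟨p, hp⟩ := h.exists_solvesForward hs hψ
  exact ⟨(hψ.toH, p), ⟨fun i => ⟨_, hψ.hasWeakPartial i⟩, hp⟩, rfl⟩

end Solutions

/-! ### The duality formula for the extended operators -/

theorem lemma1p2 (n : ℕ) (T : ℝ) (hT : 0 < T) (f : StateSpace n → ℝ → StateSpace n)
    (hf : RegularField T f) (s : ℝ) (hs : s ∈ Icc 0 T) (φ : XOneZero n T) (ρs : HZero n)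
    (v : CZero n 0 T) (hv : v = operatorL hT.le f φ)
    (ρ : CZero n s T) (hρ : ρ = operatorLstar hs.2 f ρs) :
    IntervalIntegrable (fun t => inner ℝ (φ t) (IccExtend hs.2 ρ t)) volume s T ∧
      inner ℝ (v ⟨s, hs⟩) ρs = ∫ t in s..T, inner ℝ (φ t) (IccExtend hs.2 ρ t) := by
  refine ⟨intervalIntegrable_timePairing hs φ ρ, ?_⟩
  have hvc := mem_closure_backwardGraph hT.le hf φ
  have hρc := mem_closure_forwardGraph hs hf ρs
  rw [← hv] at hvc
  rw [← hρ] at hρc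
  obtain ⟨C, β, dβ, h⟩ := hf.exists_coefficients
  -- The limits are taken one at a time: first in the backward pair with a genuine forward solution
  -- fixed, then in the forward pair. Thus continuity in each variable separately is enough.
  have h1 : ∀ z ∈ forwardGraph hs.2 f, inner ℝ (v ⟨s, hs⟩) z.1 = timePairing hs φ z.2 := by
    intro z hz
    have hcl : IsClosed {y : XOneZero n T × CZero n 0 T |
        inner ℝ (y.2 ⟨s, hs⟩) z.1 = timePairing hs y.1 z.2} :=
      isClosed_eq (((continuous_eval_const _).comp continuous_snd).inner
        continuous_const) ((continuous_timePairing_left hs z.2).comp continuous_fst)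
    exact closure_minimal (fun y hy => h.inner_eq_integral hT.le hs
      ((Lp.memLp y.1).integrable le_rfl) hy.2 hz.2) hcl hvc
  have hcl : IsClosed {z : HZero n × CZero n s T |
      inner ℝ (v ⟨s, hs⟩) z.1 = timePairing hs φ z.2} :=
    isClosed_eq (continuous_const.inner continuous_fst)
      ((continuous_timePairing_right hs φ).comp continuous_snd)
  exact closure_minimal h1 hcl hρc
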